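/- **Setting (abstract).** Let $U=\bigoplus_{p\in\mathbb Z}U_p$ be a $\mathbb Z$-graded unital associative ring with a decreasing exhaustive system of neighbourhoods of $0$ given by homogeneous additive subgroups $N^nU$ ($n\in\mathbb Z$), with $N^nU_p:=N^nU\cap U_p$, such that $(N^nU_p)\,U_q\subseteq N^{n-q}U_{p+q}$ and $U_p\,(N^nU_q)\subseteq N^nU_{p+q}$. Call it *almost canonical* if $N^nU_p=(U\,U_{\le -n})_p+N^{n+1}U_p$ for all $n,p$. Put $N_L^nU=N^nU$ and let $N_R^nU$ be the homogeneous subgroup with $N_R^{n}U_p=N^{n-p}U_p$. For $d\ge -1$ let $A_d=U_0/N^{d+1}U_0$, with quotient maps $u\mapsto[u]_d$ and projections $\pi_d\colon A_d\to A_{d-1}$. For a left $A_0$-module $W_0$ let $\Phi^L(W_0)=(U/N_L^1U)\otimes_{U_0}W_0$, a graded left $U$-module with degree $d$ part $\Phi^L(W_0)_d=(U/N^1_LU)_d\otimes_{U_0}W_0$. For homogeneous $\alpha,\beta\in U$ let $\alpha\circledast\beta=[\alpha\beta]_0\in A_0$ if $\deg\alpha+\deg\beta=0$ and $\alpha\circledast\beta=0$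 otherwise, and extend biadditively. Let $$\mathfrak A=(U/N_L^1U)\otimes_{U_0}A_0\otimes_{U_0}(U/N_R^1U),$$ which acts on $\Phi^L(W_0)$ by $(\alpha\otimes a\otimes\alpha')\star(\beta\otimes w)=\alpha\otimes a(\alpha'\circledast\beta)w$ and is an associative (possibly non-unital) ring under $(\alpha\otimes a\otimes\alpha')\star(\beta\otimes b\otimes\beta')=\alpha\otimes a(\alpha'\circledast\beta)b\otimes\beta'$. For $d\in\mathbb N$ let $\mathfrak A_d=(U/N_L^1U)_d\otimes_{U_0}A_0\otimes_{U_0}(U/N_R^1U)_{-d}$, a subring of $\mathfrak A$, and let $\mu_d\colon\mathfrak A_d\to A_d$, $\alpha\otimes[u]_0\otimes\beta\mapsto[\alpha u\beta]_d$. **Setting (vertex operator algebras).** Let $V=\bigoplus_{i\in\mathbb N}V_i$ be a vertex operator algebra of CFT type over $\mathbb C$ ($\dim V_i<\infty$, $\dim V_0=1$), with vacuum $\mathbf 1$ and conformal vector $\omega$. Let $U$ be the universal enveloping algebra of the Lie algebra $\mathfrak L(V)^f=V\otimes\mathbb C[t,t^{-1}]/\mathrm{Im}(L_{-1}\otimes\mathrm{id}+\mathrm{id}\otimes\frac{d}{dt})$,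 whose elements $a_{[i]}$ (the class of $a\otimes t^i$) have bracket $[a_{[i]},b_{[j]}]=\sum_{k\ge0}\binom ik(a_{(k)}b)_{[i+j-k]}$ and degree $\deg a-i-1$. Let $\widehat U=\bigoplus_p\varprojlim_n U_p/\big(\sum_{j\le-n}U_{p-j}U_j\big)$, and let $\mathscr U=\widehat U/\overline J$, where $\overline J$ is the (degreewise) closure of the two-sided ideal $J$ generated by $\mathbf 1_{[-1]}-1$ and the Jacobi relations $$\sum_{i\ge0}(-1)^i\binom\ell i\big(a_{[m+\ell-i]}b_{[n+i]}-(-1)^\ell b_{[n+\ell-i]}a_{[m+i]}\big)=\sum_{i\ge0}\binom mi(a_{(\ell+i)}b)_{[m+n-i]}$$ for $\ell,m,n\in\mathbb Z$ and $a,b\in V$. Then $\mathscr U$ is a graded ring with (quotient) neighbourhoods $N^n\mathscr U$ as above, and $A_d$, $\Phi^L$, $\mathfrak A_d$, $\mu_d$ for $V$ are those formed from $\mathscr U$. The rings $\mathfrak A_d$ ($d\in\mathbb N$) are said to have *strong identity elements* if every $\mathfrak A_d$ has an identity element $\mathscr I_d$ that acts as the identity on $\Phi^L(A_0)_d$. **Theorem.**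 (a) Suppose that either $U$ is a graded ring as in the abstract setting whose neighbourhoods are almost canonical, or $U=\mathscr U$ for a vertex operator algebra $V$ of CFT type. Let $d\in\mathbb N$. The sequence $$\mathfrak A_d\xrightarrow{\ \mu_d\ }A_d\xrightarrow{\ \pi_d\ }A_{d-1}\longrightarrow0$$ is exact. If $\mathfrak A_d$ has an identity element, then $\mu_d$ is injective and the sequence splits: there is a ring isomorphism $A_d\cong\mathfrak A_d\times A_{d-1}$ under which $\mu_d$ is the inclusion of the first factor and $\pi_d$ is the projection to the second. In particular, if $\mathfrak A_j$ has an identity element for every $0\le j\le d$, then $A_d\cong\mathfrak A_d\oplus\mathfrak A_{d-1}\oplus\cdots\oplus\mathfrak A_0$ as rings. (b) Let $V$ be a vertex operator algebra of CFT type for which the rings $\mathfrak A_d$, $d\in\mathbb N$, have strong identity elements. Let $W_0$ be an $A_0$-module on which $L_0=\omega_{[1]}$ acts as a scalar $c_W\in\mathbb C$, and let $W=\Phi^L(W_0)$. Then there is no non-zero proper submodule $Z\subset W$ such that $c_Z-c_W$ is a positive integer for every eigenvalue $c_Z$ of $L_0$ on $Z$. -/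

import Mathlib

open scoped DirectSum TensorProduct

universe u v w

noncomputable section

namespace ModeAlg



/-- A `ℤ`-graded (unital, associative) ring `U = ⨁ U_p` together with a system of neighbourhoods of
`0` given by homogeneous additive subgroups `N^n U` such that
`(N^n U_p) U_q ⊆ N^(n-q) U_(p+q)` and `U_p (N^n U_q) ⊆ N^n U_(p+q)`. -/
structure SeminormedGradedRing where
  carrier : Type u
  [ring : Ring carrier]
  deg : ℤ → AddSubgroup carrier
  [graded : GradedRing deg]
  nbhd : ℤ → AddSubgroup carrier
  nbhd_anti : ∀ n, nbhd (n + 1) ≤ nbhd n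
  nbhd_exhaust : ∀ x, ∃ n, x ∈ nbhd n
  nbhd_homog : ∀ n x, x ∈ nbhd n → ∀ p, (DirectSum.decompose deg x p : carrier) ∈ nbhd n
  nbhd_mul : ∀ n p q x y, x ∈ nbhd n → x ∈ deg p → y ∈ deg q → x * y ∈ nbhd (n - q)
  mul_nbhd : ∀ n p q x y, x ∈ deg p → y ∈ nbhd n → y ∈ deg q → x * y ∈ nbhd n

attribute [instance] SeminormedGradedRing.ring SeminormedGradedRing.graded

namespace SeminormedGradedRing

variable (U : SeminormedGradedRing.{u})

/-- The canonical neighbourhood `U U_{≤ -n}`. -/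
def canonicalNbhd (n : ℤ) : AddSubgroup U.carrier :=
  AddSubgroup.closure {z | ∃ x y : U.carrier, ∃ j ≤ -n, y ∈ U.deg j ∧ z = x * y}

/-- The seminorm is almost canonical: `N^n U_p = (U U_{≤ -n})_p + N^(n+1) U_p`. -/
def AlmostCanonical : Prop :=
  ∀ n p : ℤ, U.nbhd n ⊓ U.deg p = (U.canonicalNbhd n ⊓ U.deg p) ⊔ (U.nbhd (n + 1) ⊓ U.deg p)

/-- The left neighbourhoods `N_L^n U`. -/
abbrev nbhdL (n : ℤ) : AddSubgroup U.carrier := U.nbhd n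

/-- The right neighbourhoods `N_R^n U`, determined by `N_R^(n+p) U_p = N_L^n U_p`. -/
def nbhdR (n : ℤ) : AddSubgroup U.carrier where
  carrier := {x | ∀ p, (DirectSum.decompose U.deg x p : U.carrier) ∈ U.nbhd (n - p)}
  zero_mem' p := by simp
  add_mem' {x y} hx hy p := by
    simpa [DirectSum.decompose_add] using add_mem (hx p) (hy p)
  neg_mem' {x} hx p := by
    rw [DirectSum.decompose_neg]
    exact neg_mem (hx p)

/-! ### Zhu algebras -/

/-- `N^n U_0`, a two-sided ideal of `U_0`. -/
def zhuIdeal (n : ℤ) : Ideal (U.deg 0) where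
  carrier := {x | (x : U.carrier) ∈ U.nbhd n}
  zero_mem' := (U.nbhd n).zero_mem
  add_mem' hx hy := (U.nbhd n).add_mem hx hy
  smul_mem' c x hx := U.mul_nbhd n 0 0 _ _ c.2 hx x.2

instance (n : ℤ) : (U.zhuIdeal n).IsTwoSided where
  mul_mem_of_left {a} b ha := by
    have := U.nbhd_mul n 0 0 _ _ ha a.2 b.2
    rwa [sub_zero] at this

theorem zhuIdeal_anti (n : ℤ) : U.zhuIdeal (n + 1) ≤ U.zhuIdeal n :=
  fun _ hx => U.nbhd_anti n hx

/-- The `d`-th Zhu algebra `A_d = U_0 / N^(d+1) U_0`. -/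
def Zhu (d : ℤ) : Type u := U.deg 0 ⧸ U.zhuIdeal (d + 1)

instance (d : ℤ) : Ring (U.Zhu d) := inferInstanceAs (Ring (U.deg 0 ⧸ U.zhuIdeal (d + 1)))

/-- The quotient map `U_0 → A_d`, `α ↦ [α]_d`. -/
def zhuMk (d : ℤ) : U.deg 0 →+* U.Zhu d := Ideal.Quotient.mk (U.zhuIdeal (d + 1))

theorem zhuMk_surjective (d : ℤ) : Function.Surjective (U.zhuMk d) :=
  Ideal.Quotient.mk_surjective

theorem zhuMk_eq_zero {d : ℤ} {u : U.deg 0} (h : (u : U.carrier) ∈ U.nbhd (d + 1)) :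
    U.zhuMk d u = 0 :=
  Ideal.Quotient.eq_zero_iff_mem.2 h

/-- The projection `π_d : A_d → A_{d-1}`. -/
def zhuProj (d : ℤ) : U.Zhu d →+* U.Zhu (d - 1) :=
  Ideal.Quotient.factor (S := U.zhuIdeal (d + 1)) (T := U.zhuIdeal (d - 1 + 1)) (by
    have h := U.zhuIdeal_anti d
    rwa [show d - 1 + 1 = d by ring])

theorem zhuProj_mk (d : ℤ) (u : U.deg 0) : U.zhuProj d (U.zhuMk d u) = U.zhuMk (d - 1) u := rfl

/-- The projection `U → U_p`. -/
def comp (p : ℤ) : U.carrier →+ U.deg p :=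
  (DFinsupp.evalAddMonoidHom p).comp (DirectSum.decomposeAddEquiv U.deg).toAddMonoidHom

theorem comp_apply (p : ℤ) (x : U.carrier) : U.comp p x = DirectSum.decompose U.deg x p := rfl

variable {U} in
theorem comp_left {p q r : ℤ} {x : U.carrier} (hx : x ∈ U.deg p) (y : U.carrier)
    (h : p + q = r) : (U.comp r (x * y) : U.carrier) = x * U.comp q y := by
  subst h
  exact DirectSum.coe_decompose_mul_add_of_left_mem U.deg hx

variable {U} in
theorem comp_right {p q r : ℤ} {y : U.carrier} (hy : y ∈ U.deg q) (x : U.carrier)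
    (h : p + q = r) : (U.comp r (x * y) : U.carrier) = U.comp p x * y := by
  subst h
  exact DirectSum.coe_decompose_mul_add_of_right_mem U.deg hy

variable {U} in
theorem comp_of_mem {p : ℤ} {x : U.carrier} (hx : x ∈ U.deg p) : (U.comp p x : U.carrier) = x :=
  DirectSum.decompose_of_mem_same U.deg hx

/-- The pairing `α ⊛ β ∈ A_0`: for homogeneous `α`, `β` it is `[α β]_0` if `deg α + deg β = 0` and
`0` otherwise; in general it is the class of the degree `0` component of `α β`. -/
def ostar (α β : U.carrier) : U.Zhu 0 := U.zhuMk 0 (U.comp 0 (α * β))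

variable {U}

theorem ostar_add_left (α α' β : U.carrier) :
    U.ostar (α + α') β = U.ostar α β + U.ostar α' β := by
  simp [ostar, add_mul]

theorem ostar_add_right (α β β' : U.carrier) :
    U.ostar α (β + β') = U.ostar α β + U.ostar α β' := by
  simp [ostar, mul_add]

theorem ostar_zero_left (β : U.carrier) : U.ostar 0 β = 0 := by simp [ostar]

theorem ostar_zero_right (α : U.carrier) : U.ostar α 0 = 0 := by simp [ostar]

theorem ostar_zsmul_left (n : ℤ) (α β : U.carrier) : U.ostar (n • α) β = n • U.ostar α β :=
  map_zsmul (AddMonoidHom.mk' (fun α => U.ostar α β) fun a b => ostar_add_left a b β) n α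

theorem ostar_mul_middle (α γ β : U.carrier) : U.ostar (α * γ) β = U.ostar α (γ * β) := by
  simp [ostar, mul_assoc]

theorem ostar_mul_left (v : U.deg 0) (α β : U.carrier) :
    U.ostar (v * α) β = U.zhuMk 0 v * U.ostar α β := by
  rw [ostar, ostar, ← map_mul]
  congr 1
  apply Subtype.ext
  rw [mul_assoc, comp_left v.2 _ (zero_add 0)]
  rfl

theorem ostar_mul_right (v : U.deg 0) (α β : U.carrier) :
    U.ostar α (β * v) = U.ostar α β * U.zhuMk 0 v := by
  rw [ostar, ostar, ← map_mul]
  congr 1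
  apply Subtype.ext
  rw [← mul_assoc, comp_right v.2 _ (zero_add 0)]
  rfl

theorem ostar_of_nbhdR {α : U.carrier} (hα : α ∈ U.nbhdR 1) (β : U.carrier) :
    U.ostar α β = 0 := by
  refine DirectSum.Decomposition.inductionOn U.deg (ostar_zero_right α) ?_ ?_ β
  · intro q b
    refine zhuMk_eq_zero _ ?_
    rw [comp_right b.2 α (p := -q) (by ring)]
    have := U.nbhd_mul _ _ _ _ _ (hα (-q)) (U.comp (-q) α).2 b.2
    rwa [show (1 : ℤ) - -q - q = 0 + 1 by ring] at this
  · intro b b' h h'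
    rw [ostar_add_right, h, h', add_zero]

theorem ostar_of_nbhdL {β : U.carrier} (hβ : β ∈ U.nbhdL 1) (α : U.carrier) :
    U.ostar α β = 0 := by
  refine DirectSum.Decomposition.inductionOn U.deg (ostar_zero_left β) ?_ ?_ α
  · intro p a
    refine zhuMk_eq_zero _ ?_
    rw [comp_left a.2 β (q := -p) (by ring)]
    exact U.mul_nbhd _ _ _ _ _ a.2 (U.nbhd_homog _ _ hβ (-p)) (U.comp (-p) β).2
  · intro b b' h h'
    rw [ostar_add_left, h, h', add_zero]

/-! ### Induced modules -/

variable (U)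

section PhiL

variable (W : Type w) [AddCommGroup W] [Module (U.Zhu 0) W]

/-- The relations presenting `(U / N_L^1 U) ⊗_{U_0} W` as a quotient of `U ⊗_ℤ W`. -/
def phiLGen : Set (U.carrier ⊗[ℤ] W) :=
  {x | ∃ α ∈ U.nbhdL 1, ∃ m : W, x = α ⊗ₜ m} ∪
  {x | ∃ (α : U.carrier) (a : U.deg 0) (m : W),
    x = (α * a) ⊗ₜ m - α ⊗ₜ (U.zhuMk 0 a • m)}

/-- The generalized Verma module `Φ^L(W) = (U / N_L^1 U) ⊗_{U_0} W`, a left `U`-module. The set of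
relations is stable under left multiplication by `U`, so that the `U`-submodule it spans is also the
additive subgroup it generates. -/
def PhiL : Type (max u w) := (U.carrier ⊗[ℤ] W) ⧸ Submodule.span U.carrier (U.phiLGen W)

instance : AddCommGroup (U.PhiL W) :=
  inferInstanceAs (AddCommGroup ((U.carrier ⊗[ℤ] W) ⧸ Submodule.span U.carrier (U.phiLGen W)))

instance : Module U.carrier (U.PhiL W) :=
  inferInstanceAs
    (Module U.carrier ((U.carrier ⊗[ℤ] W) ⧸ Submodule.span U.carrier (U.phiLGen W)))

variable {W} in
/-- The element `α ⊗ m` of `Φ^L(W)`. -/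
def phiLTmul (α : U.carrier) (m : W) : U.PhiL W :=
  Submodule.Quotient.mk (p := Submodule.span U.carrier (U.phiLGen W)) (α ⊗ₜ m)

/-- The degree `d` part `Φ^L(W)_d = (U / N_L^1 U)_d ⊗_{U_0} W`. -/
def phiLDeg (d : ℤ) : AddSubgroup (U.PhiL W) :=
  AddSubgroup.closure {x | ∃ α ∈ U.deg d, ∃ m : W, x = U.phiLTmul α m}

variable {U W}

/-- A biadditive map induces an additive map on the tensor product over `ℤ`. -/
def addLift {M N P : Type*} [AddCommGroup M] [AddCommGroup N] [AddCommGroup P]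
    (f : M →+ N →+ P) : M ⊗[ℤ] N →+ P :=
  TensorProduct.liftAddHom f fun n m x => by
    rw [map_zsmul, map_zsmul]
    rfl

theorem addLift_tmul {M N P : Type*} [AddCommGroup M] [AddCommGroup N] [AddCommGroup P]
    (f : M →+ N →+ P) (m : M) (x : N) : addLift f (m ⊗ₜ x) = f m x := rfl

theorem phiLGen_smul (γ : U.carrier) {x : U.carrier ⊗[ℤ] W} (hx : x ∈ U.phiLGen W) :
    γ • x ∈ AddSubgroup.closure (U.phiLGen W) := by
  rcases hx with ⟨α, hα, m, rfl⟩ | ⟨α, a, m, rfl⟩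
  · rw [TensorProduct.smul_tmul']
    refine DirectSum.Decomposition.inductionOn U.deg
      (motive := fun γ => (γ • α) ⊗ₜ[ℤ] m ∈ AddSubgroup.closure (U.phiLGen W)) ?_ ?_ ?_ γ
    · simp
    · intro p c
      apply AddSubgroup.subset_closure
      left
      refine ⟨_, ?_, m, rfl⟩
      classical
      rw [smul_eq_mul, ← DirectSum.sum_support_decompose U.deg α, Finset.mul_sum]
      exact sum_mem fun i _ => U.mul_nbhd _ _ _ _ _ c.2 (U.nbhd_homog _ _ hα i) (SetLike.coe_mem _)
    · intro b c hb hc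
      rw [add_smul, TensorProduct.add_tmul]
      exact add_mem hb hc
  · apply AddSubgroup.subset_closure
    right
    refine ⟨γ * α, a, m, ?_⟩
    simp [smul_sub, TensorProduct.smul_tmul', mul_assoc]

/-- An additive map on `U ⊗_ℤ W` that kills the relations of `Φ^L(W)` descends to `Φ^L(W)`. -/
def phiLLift {P : Type*} [AddCommGroup P] (φ : U.carrier ⊗[ℤ] W →+ P)
    (h1 : ∀ α ∈ U.nbhdL 1, ∀ m, φ (α ⊗ₜ m) = 0)
    (h2 : ∀ (α : U.carrier) (a : U.deg 0) (m : W),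
      φ ((α * a) ⊗ₜ m) = φ (α ⊗ₜ (U.zhuMk 0 a • m))) : U.PhiL W →+ P :=
  QuotientAddGroup.lift (Submodule.span U.carrier (U.phiLGen W)).toAddSubgroup φ <| by
    have h0 : AddSubgroup.closure (U.phiLGen W) ≤ φ.ker := by
      rw [AddSubgroup.closure_le]
      rintro x (⟨α, hα, m, rfl⟩ | ⟨α, a, m, rfl⟩)
      · exact h1 α hα m
      · change φ _ = 0
        rw [map_sub, h2, sub_self]
    intro x hx
    have key : ∀ γ : U.carrier, φ (γ • x) = 0 := by
      refine Submodule.span_induction (p := fun x _ => ∀ γ : U.carrier, φ (γ • x) = 0)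
        ?_ ?_ ?_ ?_ hx
      · intro x hx γ
        exact h0 (phiLGen_smul γ hx)
      · simp
      · intro x y _ _ hx hy γ
        rw [smul_add, map_add, hx, hy, add_zero]
      · intro δ x _ hx γ
        rw [smul_smul, hx]
    simpa using key 1

theorem phiLLift_tmul {P : Type*} [AddCommGroup P] (φ : U.carrier ⊗[ℤ] W →+ P) (h1) (h2)
    (α : U.carrier) (m : W) : phiLLift φ h1 h2 (U.phiLTmul α m) = φ (α ⊗ₜ m) := rfl

theorem smul_phiLTmul (γ α : U.carrier) (m : W) : γ • U.phiLTmul α m = U.phiLTmul (γ * α) m := rfl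

theorem phiL_induction {P : U.PhiL W → Prop} (x : U.PhiL W) (h0 : P 0)
    (ht : ∀ α m, P (U.phiLTmul α m)) (ha : ∀ x y, P x → P y → P (x + y)) : P x := by
  obtain ⟨x, rfl⟩ := Submodule.Quotient.mk_surjective _ x
  induction x using TensorProduct.induction_on with
  | zero => exact h0
  | tmul α m => exact ht α m
  | add x y hx hy => exact ha _ _ hx hy

theorem phiLTmul_mul (α : U.carrier) (a : U.deg 0) (m : W) :
    U.phiLTmul (α * a) m = U.phiLTmul α (U.zhuMk 0 a • m) :=
  (Submodule.Quotient.eq _).2 (Submodule.subset_span (Or.inr ⟨α, a, m, rfl⟩))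

theorem phiLTmul_nbhd {α : U.carrier} (hα : α ∈ U.nbhdL 1) (m : W) : U.phiLTmul α m = 0 :=
  (Submodule.Quotient.mk_eq_zero _).2 (Submodule.subset_span (Or.inl ⟨α, hα, m, rfl⟩))

variable {W' : Type*} [AddCommGroup W'] [Module (U.Zhu 0) W']

theorem phiLTmul_add_right (α : U.carrier) (m m' : W) :
    U.phiLTmul α (m + m') = U.phiLTmul α m + U.phiLTmul α m' :=
  congrArg (Submodule.Quotient.mk (p := Submodule.span U.carrier (U.phiLGen W)))
    (TensorProduct.tmul_add α m m')

theorem phiLTmul_add_left (α α' : U.carrier) (m : W) :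
    U.phiLTmul (α + α') m = U.phiLTmul α m + U.phiLTmul α' m :=
  congrArg (Submodule.Quotient.mk (p := Submodule.span U.carrier (U.phiLGen W)))
    (TensorProduct.add_tmul α α' m)

theorem phiLTmul_zero_right (α : U.carrier) : U.phiLTmul α (0 : W) = 0 :=
  congrArg (Submodule.Quotient.mk (p := Submodule.span U.carrier (U.phiLGen W)))
    (TensorProduct.tmul_zero W α)

theorem phiLTmul_zero_left (m : W) : U.phiLTmul (0 : U.carrier) m = 0 :=
  congrArg (Submodule.Quotient.mk (p := Submodule.span U.carrier (U.phiLGen W)))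
    (TensorProduct.zero_tmul U.carrier m)

/-- The functoriality of `Φ^L`. -/
def phiLMap (f : W →ₗ[U.Zhu 0] W') : U.PhiL W →+ U.PhiL W' :=
  phiLLift (addLift
      { toFun := fun α =>
          { toFun := fun m => U.phiLTmul α (f m)
            map_zero' := by simp [phiLTmul_zero_right]
            map_add' := by simp [phiLTmul_add_right] }
        map_zero' := by ext; simp [phiLTmul_zero_left]
        map_add' := fun α β => by ext; simp [phiLTmul_add_left] })
    (fun α hα m => phiLTmul_nbhd hα _)
    (fun α a m => by
      change U.phiLTmul (α * a) (f m) = U.phiLTmul α (f (U.zhuMk 0 a • m))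
      rw [phiLTmul_mul, map_smul])

theorem phiLMap_tmul (f : W →ₗ[U.Zhu 0] W') (α : U.carrier) (m : W) :
    phiLMap f (U.phiLTmul α m) = U.phiLTmul α (f m) := rfl

end PhiL

/-! ### The mode transition algebra -/

/-- The relations presenting `A_0 ⊗_{U_0} (U / N_R^1 U)` as a quotient of `A_0 ⊗_ℤ U`. -/
def phiRGen : Set (U.Zhu 0 ⊗[ℤ] U.carrier) :=
  {x | ∃ (a : U.Zhu 0), ∃ β ∈ U.nbhdR 1, x = a ⊗ₜ β} ∪
  {x | ∃ (a : U.Zhu 0) (b : U.deg 0) (β : U.carrier),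
    x = (a * U.zhuMk 0 b) ⊗ₜ β - a ⊗ₜ ((b : U.carrier) * β)}

/-- The right induced module `Φ^R(A_0) = A_0 ⊗_{U_0} (U / N_R^1 U)`, as a left `A_0`-module. -/
def PhiRZhu : Type u :=
  (U.Zhu 0 ⊗[ℤ] U.carrier) ⧸ Submodule.span (U.Zhu 0) U.phiRGen

instance : AddCommGroup U.PhiRZhu :=
  inferInstanceAs
    (AddCommGroup ((U.Zhu 0 ⊗[ℤ] U.carrier) ⧸ Submodule.span (U.Zhu 0) U.phiRGen))

instance : Module (U.Zhu 0) U.PhiRZhu :=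
  inferInstanceAs
    (Module (U.Zhu 0) ((U.Zhu 0 ⊗[ℤ] U.carrier) ⧸ Submodule.span (U.Zhu 0) U.phiRGen))

/-- The element `a ⊗ β` of `Φ^R(A_0)`. -/
def phiRTmul (a : U.Zhu 0) (β : U.carrier) : U.PhiRZhu :=
  Submodule.Quotient.mk (p := Submodule.span (U.Zhu 0) U.phiRGen) (a ⊗ₜ β)

/-- The mode transition algebra
`𝔄 = Φ^L(Φ^R(A_0)) = (U / N_L^1 U) ⊗_{U_0} A_0 ⊗_{U_0} (U / N_R^1 U)`. -/
def MTA : Type u := U.PhiL U.PhiRZhu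

instance : AddCommGroup U.MTA := inferInstanceAs (AddCommGroup (U.PhiL U.PhiRZhu))

/-- The element `α ⊗ a ⊗ β` of `𝔄`. -/
def mtaTmul (α : U.carrier) (a : U.Zhu 0) (β : U.carrier) : U.MTA :=
  U.phiLTmul α (U.phiRTmul a β)

variable {U}

section Star

variable {W : Type w} [AddCommGroup W] [Module (U.Zhu 0) W]

/-- For `β ∈ U` and `m ∈ W`, the `A_0`-linear map `Φ^R(A_0) → W`, `a ⊗ α' ↦ a (α' ⊛ β) m`. -/
def pair (β : U.carrier) (m : W) : U.PhiRZhu →ₗ[U.Zhu 0] W :=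
  Submodule.liftQ (Submodule.span (U.Zhu 0) U.phiRGen)
    (TensorProduct.AlgebraTensorModule.lift
      (LinearMap.mk₂' (U.Zhu 0) ℤ (fun (a : U.Zhu 0) (α' : U.carrier) => a • (U.ostar α' β • m))
        (fun a b c => add_smul _ _ _) (fun r a c => by rw [smul_eq_mul, mul_smul])
        (fun a b c => by rw [ostar_add_left, add_smul, smul_add])
        (fun n a c => by rw [ostar_zsmul_left, smul_assoc, smul_comm]) :
        U.Zhu 0 →ₗ[U.Zhu 0] U.carrier →ₗ[ℤ] W))
    (by
      rw [Submodule.span_le]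
      rintro x (⟨a, α', h, rfl⟩ | ⟨a, b, α', rfl⟩)
      · simp [ostar_of_nbhdR h]
      · simp [ostar_mul_left, mul_smul])

theorem pair_tmul (β : U.carrier) (m : W) (a : U.Zhu 0) (α' : U.carrier) :
    pair β m (U.phiRTmul a α') = a • (U.ostar α' β • m) := rfl

theorem phiR_induction {P : U.PhiRZhu → Prop} (x : U.PhiRZhu) (h0 : P 0)
    (ht : ∀ a β, P (U.phiRTmul a β)) (ha : ∀ x y, P x → P y → P (x + y)) : P x := by
  obtain ⟨x, rfl⟩ := Submodule.Quotient.mk_surjective _ x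
  induction x using TensorProduct.induction_on with
  | zero => exact h0
  | tmul a β => exact ht a β
  | add x y hx hy => exact ha _ _ hx hy

theorem mta_induction {P : U.MTA → Prop} (x : U.MTA) (h0 : P 0)
    (ht : ∀ α a β, P (U.mtaTmul α a β)) (ha : ∀ x y, P x → P y → P (x + y)) : P x := by
  refine phiL_induction (U := U) (W := U.PhiRZhu) (P := P) x h0 (fun α m => ?_) ha
  refine phiR_induction (P := fun m => P (U.phiLTmul α m)) m ?_ (fun a β => ht α a β) fun x y hx hy => ?_
  · rw [phiLTmul_zero_right]; exact h0
  · rw [phiLTmul_add_right]; exact ha _ _ hx hy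

theorem mta_hom_ext {P : Type*} [AddCommGroup P] {f g : U.MTA →+ P}
    (h : ∀ α a β, f (U.mtaTmul α a β) = g (U.mtaTmul α a β)) : f = g := by
  ext x
  refine mta_induction (P := fun x => f x = g x) x (by simp) h fun x y hx hy => ?_
  rw [map_add, map_add, hx, hy]

/-- The map `𝔄 → Φ^L(W)`, `x ↦ x ⋆ (β ⊗ m)`. -/
def starAux (β : U.carrier) (m : W) : U.MTA →+ U.PhiL W := phiLMap (pair β m)

theorem starAux_tmul (β : U.carrier) (m : W) (α : U.carrier) (a : U.Zhu 0) (α' : U.carrier) :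
    starAux β m (U.mtaTmul α a α') = U.phiLTmul α (a • (U.ostar α' β • m)) := rfl

/-- The map `Φ^L(W) → Hom(𝔄, Φ^L(W))`, `y ↦ (x ↦ x ⋆ y)`. -/
def starHom : U.PhiL W →+ U.MTA →+ U.PhiL W :=
  phiLLift (addLift
      { toFun := fun β =>
          { toFun := fun m => starAux β m
            map_zero' := mta_hom_ext fun α a α' => by
              simp [starAux_tmul, phiLTmul_zero_right]
            map_add' := fun m m' => mta_hom_ext fun α a α' => by
              simp [starAux_tmul, phiLTmul_add_right] }
        map_zero' := by
          ext1 m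
          exact mta_hom_ext fun α a α' => by
            simp [starAux_tmul, ostar_zero_right, phiLTmul_zero_right]
        map_add' := fun β β' => by
          ext1 m
          exact mta_hom_ext fun α a α' => by
            simp [starAux_tmul, ostar_add_right, add_smul, phiLTmul_add_right] })
    (fun β hβ m => mta_hom_ext fun α a α' => by
      change U.phiLTmul α (a • (U.ostar α' β • m)) = 0
      rw [ostar_of_nbhdL hβ, zero_smul, smul_zero, phiLTmul_zero_right])
    (fun β b m => mta_hom_ext fun α a α' => by
      change U.phiLTmul α (a • (U.ostar α' (β * b) • m)) =
        U.phiLTmul α (a • (U.ostar α' β • U.zhuMk 0 b • m))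
      rw [ostar_mul_right, mul_smul])

/-- The action `⋆` of `𝔄` on `Φ^L(W)`. -/
def star (x : U.MTA) (y : U.PhiL W) : U.PhiL W := starHom y x

/-- `(α ⊗ a ⊗ α') ⋆ (β ⊗ m) = α ⊗ a (α' ⊛ β) m`. -/
theorem star_tmul (α : U.carrier) (a : U.Zhu 0) (α' β : U.carrier) (m : W) :
    star (U.mtaTmul α a α') (U.phiLTmul β m) = U.phiLTmul α (a • (U.ostar α' β • m)) := rfl

theorem star_add (x : U.MTA) (y y' : U.PhiL W) : star x (y + y') = star x y + star x y' := by
  simp [star]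

theorem add_star (x x' : U.MTA) (y : U.PhiL W) : star (x + x') y = star x y + star x' y := by
  simp [star]

theorem star_zero (x : U.MTA) : star x (0 : U.PhiL W) = 0 := by simp [star]

theorem zero_star (y : U.PhiL W) : star (0 : U.MTA) y = 0 := by simp [star]

end Star

instance : Mul U.MTA := ⟨fun x y => star (W := U.PhiRZhu) x y⟩

/-- `(α ⊗ a ⊗ α') ⋆ (β ⊗ b ⊗ β') = α ⊗ a (α' ⊛ β) b ⊗ β'`. -/
theorem mtaTmul_mul (α : U.carrier) (a : U.Zhu 0) (α' β : U.carrier) (b : U.Zhu 0)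
    (β' : U.carrier) :
    U.mtaTmul α a α' * U.mtaTmul β b β' = U.mtaTmul α (a * (U.ostar α' β * b)) β' := rfl

theorem mta_add_mul (x x' y : U.MTA) : (x + x') * y = x * y + x' * y :=
  add_star (W := U.PhiRZhu) x x' y

theorem mta_mul_add (x y y' : U.MTA) : x * (y + y') = x * y + x * y' :=
  star_add (W := U.PhiRZhu) x y y'

theorem mta_zero_mul (y : U.MTA) : (0 : U.MTA) * y = 0 := zero_star (W := U.PhiRZhu) y

theorem mta_mul_zero (x : U.MTA) : x * (0 : U.MTA) = 0 := star_zero (W := U.PhiRZhu) x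

theorem mul_star {W : Type w} [AddCommGroup W] [Module (U.Zhu 0) W] (x y : U.MTA)
    (z : U.PhiL W) : star (x * y) z = star x (star y z) := by
  refine mta_induction (P := fun x => star (x * y) z = star x (star y z)) x ?_ ?_ ?_
  · rw [mta_zero_mul, zero_star, zero_star]
  · intro α a α'
    refine mta_induction (P := fun y => star (U.mtaTmul α a α' * y) z =
      star (U.mtaTmul α a α') (star y z)) y ?_ ?_ ?_
    · rw [mta_mul_zero, zero_star, star_zero]
    · intro β b β'
      refine phiL_induction (P := fun z => star (U.mtaTmul α a α' * U.mtaTmul β b β') z =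
        star (U.mtaTmul α a α') (star (U.mtaTmul β b β') z)) z ?_ ?_ ?_
      · simp only [star_zero]
      · intro γ m
        rw [mtaTmul_mul, star_tmul, star_tmul, star_tmul]
        simp only [mul_smul]
      · intro z z' h h'
        simp only [star_add, h, h']
    · intro y y' h h'
      rw [mta_mul_add, add_star, add_star, h, h', star_add]
  · intro x x' h h'
    rw [mta_add_mul, add_star, add_star, h, h']

instance : NonUnitalRing U.MTA :=
  { (inferInstance : AddCommGroup U.MTA), (inferInstance : Mul U.MTA) with
    left_distrib := mta_mul_add
    right_distrib := mta_add_mul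
    zero_mul := mta_zero_mul
    mul_zero := mta_mul_zero
    mul_assoc := fun x y z => mul_star (W := U.PhiRZhu) x y z }

variable (U)

/-- The bigraded piece `𝔄_{p,q} = (U / N_L^1 U)_p ⊗ A_0 ⊗ (U / N_R^1 U)_q`. -/
def mtaBideg (p q : ℤ) : AddSubgroup U.MTA :=
  AddSubgroup.closure {x | ∃ α ∈ U.deg p, ∃ (a : U.Zhu 0), ∃ β ∈ U.deg q, x = U.mtaTmul α a β}

/-- The `d`-th mode transition algebra `𝔄_d = 𝔄_{d,-d}`. -/
def MTAd (d : ℕ) : NonUnitalSubring U.MTA :=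
  { U.mtaBideg d (-d) with
    mul_mem' := by
      intro x y hx hy
      change x * y ∈ U.mtaBideg d (-d)
      refine AddSubgroup.closure_induction₂ (p := fun x y _ _ => x * y ∈ U.mtaBideg d (-d))
        ?_ ?_ ?_ ?_ ?_ ?_ ?_ hx hy
      · rintro _ _ ⟨α, hα, a, α', hα', rfl⟩ ⟨β, hβ, b, β', hβ', rfl⟩
        rw [mtaTmul_mul]
        exact AddSubgroup.subset_closure ⟨_, hα, _, _, hβ', rfl⟩
      · intro x _; rw [zero_mul]; exact zero_mem _
      · intro x _; rw [mul_zero]; exact zero_mem _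
      · intro x y z _ _ _ h h'; rw [add_mul]; exact add_mem h h'
      · intro x y z _ _ _ h h'; rw [mul_add]; exact add_mem h h'
      · intro x y _ _ h; rw [neg_mul]; exact neg_mem h
      · intro x y _ _ h; rw [mul_neg]; exact neg_mem h }

/-- `e` is an identity element of the ring `𝔄_d`. -/
def IsIdentity (d : ℕ) (e : U.MTAd d) : Prop := ∀ x : U.MTAd d, e * x = x ∧ x * e = x

/-- `𝔄_d` admits an identity element. -/
def HasIdentity (d : ℕ) : Prop := ∃ e : U.MTAd d, U.IsIdentity d e

/-- Every `𝔄_d` admits a strong identity element: an identity element that acts as the identity on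
`Φ^L(A_0)_d`, i.e. such that the homomorphism `𝔄_d → End(Φ^L(A_0)_d)` is unital. -/
def HasStrongIdentities : Prop :=
  ∀ d : ℕ, ∃ e : U.MTAd d, U.IsIdentity d e ∧
    ∀ y ∈ U.phiLDeg (U.Zhu 0) d, star (e : U.MTA) y = y

/-! ### The map `μ_d` -/

variable {U}

/-- For `α, β ∈ U`, the map `A_0 → A_d`, `[u]_0 ↦ [α_d u β_{-d}]_d`. -/
def muMid (d : ℤ) (α β : U.carrier) : U.Zhu 0 →+ U.Zhu d :=
  QuotientAddGroup.lift (U.zhuIdeal (0 + 1)).toAddSubgroup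
    { toFun := fun u => U.zhuMk d (U.comp 0 (U.comp d α * (u * U.comp (-d) β)))
      map_zero' := by simp
      map_add' := fun x y => by simp [add_mul, mul_add] }
    (by
      intro u hu
      refine zhuMk_eq_zero _ ?_
      rw [comp_left (U.comp d α).2 _ (q := -d) (by ring),
        comp_right (U.comp (-d) β).2 _ (p := 0) (by ring), comp_of_mem u.2]
      have h := U.nbhd_mul _ _ _ _ _ hu u.2 (U.comp (-d) β).2
      have h' := U.mul_nbhd _ _ (0 + -d) _ _ (U.comp d α).2 h
        (SetLike.mul_mem_graded u.2 (U.comp (-d) β).2)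
      rwa [show (0 + 1 - -d : ℤ) = d + 1 by ring] at h')

theorem muMid_mk (d : ℤ) (α β : U.carrier) (u : U.deg 0) :
    muMid d α β (U.zhuMk 0 u) = U.zhuMk d (U.comp 0 (U.comp d α * (u * U.comp (-d) β))) := rfl

/-- For `α ∈ U`, the map `A_0 × U → A_d`, `([u]_0, β) ↦ [α_d u β_{-d}]_d`. -/
def muPre (d : ℤ) (α : U.carrier) : U.Zhu 0 →+ U.carrier →+ U.Zhu d where
  toFun a :=
    { toFun := fun β => muMid d α β a
      map_zero' := by
        obtain ⟨u, rfl⟩ := U.zhuMk_surjective _ a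
        simp [muMid_mk]
      map_add' := fun β β' => by
        obtain ⟨u, rfl⟩ := U.zhuMk_surjective _ a
        simp [muMid_mk, mul_add] }
  map_zero' := by ext; simp
  map_add' _ _ := by ext; simp

/-- For `α ∈ U`, the map `Φ^R(A_0) → A_d`, `[u]_0 ⊗ β ↦ [α_d u β_{-d}]_d`. -/
def muRight (d : ℤ) (α : U.carrier) : U.PhiRZhu →+ U.Zhu d :=
  QuotientAddGroup.lift (Submodule.span (U.Zhu 0) U.phiRGen).toAddSubgroup
    (addLift (muPre d α))
    (by
      intro x hx
      set φ := addLift (muPre d α) with hφ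
      have hφt : ∀ (a : U.Zhu 0) (β : U.carrier), φ (a ⊗ₜ β) = muMid d α β a := fun _ _ => rfl
      have key : ∀ c : U.Zhu 0, φ (c • x) = 0 := by
        refine Submodule.span_induction (p := fun x _ => ∀ c : U.Zhu 0, φ (c • x) = 0)
          ?_ ?_ ?_ ?_ hx
        · rintro x (⟨a, β, hβ, rfl⟩ | ⟨a, b, β, rfl⟩) c
          · rw [TensorProduct.smul_tmul', hφt]
            obtain ⟨u, hu⟩ := U.zhuMk_surjective _ (c • a)
            rw [← hu, muMid_mk]
            refine zhuMk_eq_zero _ ?_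
            rw [comp_left (U.comp d α).2 _ (q := -d) (by ring),
              comp_right (U.comp (-d) β).2 _ (p := 0) (by ring), comp_of_mem u.2]
            have h := hβ (-d)
            have h2 := U.mul_nbhd _ _ _ _ _ u.2 h (U.comp (-d) β).2
            have h3 := U.mul_nbhd _ _ (0 + -d) _ _ (U.comp d α).2 h2
              (SetLike.mul_mem_graded u.2 (U.comp (-d) β).2)
            rwa [show (1 - -d : ℤ) = d + 1 by ring] at h3
          · rw [smul_sub, TensorProduct.smul_tmul', TensorProduct.smul_tmul', map_sub, hφt, hφt,
              sub_eq_zero, smul_eq_mul, smul_eq_mul, ← mul_assoc]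
            obtain ⟨u, hu⟩ := U.zhuMk_surjective _ (c * a)
            rw [← hu, ← map_mul, muMid_mk, muMid_mk]
            have h : ((u * b : U.deg 0) : U.carrier) * U.comp (-d) β =
                u * U.comp (-d) ((b : U.carrier) * β) := by
              rw [comp_left b.2 β (zero_add (-d)), ← mul_assoc]
              rfl
            rw [h]
        · simp
        · intro x y _ _ hx hy c
          rw [smul_add, map_add, hx, hy, add_zero]
        · intro e x _ hx c
          rw [smul_smul, hx]
      simpa using key 1)

theorem muRight_tmul (d : ℤ) (α : U.carrier) (u : U.deg 0) (β : U.carrier) :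
    muRight d α (U.phiRTmul (U.zhuMk 0 u) β) =
      U.zhuMk d (U.comp 0 (U.comp d α * (u * U.comp (-d) β))) := rfl

theorem phiR_hom_ext {P : Type*} [AddCommGroup P] {f g : U.PhiRZhu →+ P}
    (h : ∀ (u : U.deg 0) β, f (U.phiRTmul (U.zhuMk 0 u) β) = g (U.phiRTmul (U.zhuMk 0 u) β)) :
    f = g := by
  ext x
  refine phiR_induction (P := fun x => f x = g x) x (by simp) (fun a β => ?_) fun x y hx hy => ?_
  · obtain ⟨u, rfl⟩ := U.zhuMk_surjective _ a
    exact h u β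
  · rw [map_add, map_add, hx, hy]

/-- The map `𝔄 → A_d`, `α ⊗ [u]_0 ⊗ β ↦ [α_d u β_{-d}]_d`. -/
def muFull (d : ℤ) : U.MTA →+ U.Zhu d :=
  phiLLift (U := U) (W := U.PhiRZhu)
    (addLift
      { toFun := fun α => muRight d α
        map_zero' := phiR_hom_ext fun u β => by simp [muRight_tmul]
        map_add' := fun α α' => phiR_hom_ext fun u β => by simp [muRight_tmul, add_mul] })
    (fun α hα m => by
      have : muRight d α = 0 := phiR_hom_ext fun u β => by
        rw [muRight_tmul]
        refine zhuMk_eq_zero _ ?_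
        have hm : (u : U.carrier) * U.comp (-d) β ∈ U.deg (0 + -d) :=
          SetLike.mul_mem_graded u.2 (U.comp (-d) β).2
        rw [comp_left (U.comp d α).2 _ (q := -d) (by ring),
          comp_right (U.comp (-d) β).2 _ (p := 0) (by ring), comp_of_mem u.2]
        have h := U.nbhd_mul _ _ _ _ _ (U.nbhd_homog _ _ hα d) (U.comp d α).2 hm
        rwa [show (1 - (0 + -d) : ℤ) = d + 1 by ring] at h
      change muRight d α m = 0
      rw [this]; rfl)
    (fun α a m => by
      change muRight d (α * (a : U.carrier)) m = muRight d α (U.zhuMk 0 a • m)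
      refine phiR_induction (P := fun m => muRight d (α * (a : U.carrier)) m = muRight d α (U.zhuMk 0 a • m))
        m (by simp) (fun b β => ?_) fun x y hx hy => ?_
      · obtain ⟨u, rfl⟩ := U.zhuMk_surjective _ b
        have : U.zhuMk 0 a • U.phiRTmul (U.zhuMk 0 u) β = U.phiRTmul (U.zhuMk 0 (a * u)) β := rfl
        rw [this, muRight_tmul, muRight_tmul, comp_right a.2 α (add_zero d)]
        congr 2
        simp [mul_assoc]
      · rw [smul_add, map_add, map_add, hx, hy])

variable (U)

/-- The map `μ_d : 𝔄_d → A_d`, `α ⊗ [u]_0 ⊗ β ↦ [α u β]_d`. -/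
def mu (d : ℕ) : U.MTAd d →+ U.Zhu d := (muFull (d : ℤ)).comp (U.mtaBideg d (-d)).subtype

/-- `μ_d(α ⊗ [u]_0 ⊗ β) = [α u β]_d` for `α ∈ U_d`, `u ∈ U_0`, `β ∈ U_{-d}`. -/
theorem mu_tmul (d : ℕ) (α : U.deg d) (u : U.deg 0) (β : U.deg (-d : ℤ))
    (h : U.mtaTmul α (U.zhuMk 0 u) β ∈ U.MTAd d)
    (h' : (α : U.carrier) * u * β ∈ U.deg 0) :
    U.mu d ⟨_, h⟩ = U.zhuMk d ⟨α * u * β, h'⟩ := by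
  change U.zhuMk d (U.comp 0 (U.comp d (α : U.carrier) * (u * U.comp (-d) (β : U.carrier)))) = _
  congr 1
  apply Subtype.ext
  rw [comp_of_mem α.2, comp_of_mem β.2, ← mul_assoc, comp_of_mem h']

/-- The sequence `𝔄_d → A_d → A_{d-1} → 0` splits at `d` as a product of rings: there is a ring
isomorphism `A_d ≅ 𝔄_d × A_{d-1}` that identifies `μ_d` with the inclusion of the first factor and
`π_d` with the projection to the second one. -/
def SplitsAsProduct (d : ℕ) : Prop :=
  ∃ e : U.Zhu d ≃+* U.MTAd d × U.Zhu (d - 1),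
    (∀ x : U.MTAd d, e (U.mu d x) = (x, 0)) ∧ ∀ a : U.Zhu d, (e a).2 = U.zhuProj d a

end SeminormedGradedRing

/-! ### Graded completion with respect to the canonical neighbourhoods -/

section Completion

variable {R : Type u} [Ring R] (𝒜 : ℤ → AddSubgroup R)

/-- The canonical neighbourhood `N_L^n R_p = (R R_{≤ -n})_p = ∑_{j ≤ -n} R_{p-j} R_j`. -/
def gradedNbhd (n p : ℤ) : AddSubgroup R :=
  AddSubgroup.closure {z | ∃ j ≤ -n, ∃ x ∈ 𝒜 (p - j), ∃ y ∈ 𝒜 j, z = x * y}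

/-- The quotient `R_p / N_L^n R_p`. -/
abbrev GradedQuot (n p : ℤ) : Type u := 𝒜 p ⧸ (gradedNbhd 𝒜 n p).addSubgroupOf (𝒜 p)

/-- The class of an element of `R_p` in `R_p / N_L^n R_p`. -/
abbrev gq (n p : ℤ) : 𝒜 p →+ GradedQuot 𝒜 n p :=
  QuotientAddGroup.mk' ((gradedNbhd 𝒜 n p).addSubgroupOf (𝒜 p))

variable {𝒜}

theorem gq_eq {n p : ℤ} {u v : 𝒜 p} :
    gq 𝒜 n p u = gq 𝒜 n p v ↔ (u : R) - v ∈ gradedNbhd 𝒜 n p := by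
  rw [← sub_eq_zero, ← map_sub, QuotientAddGroup.mk'_apply, QuotientAddGroup.eq_zero_iff,
    AddSubgroup.mem_addSubgroupOf]
  rfl

theorem gradedNbhd_anti {m n : ℤ} (h : m ≤ n) (p : ℤ) : gradedNbhd 𝒜 n p ≤ gradedNbhd 𝒜 m p :=
  AddSubgroup.closure_mono fun _ ⟨j, hj, hz⟩ => ⟨j, by lia, hz⟩

variable (𝒜)

/-- The completion `R̂_p = lim_n R_p / N_L^n R_p`, as the group of compatible families. -/
def complPiece (p : ℤ) : AddSubgroup (∀ n : ℤ, GradedQuot 𝒜 n p) where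
  carrier := {x | ∀ n, ∃ u : 𝒜 p, ∀ m ≤ n, x m = gq 𝒜 m p u}
  zero_mem' n := ⟨0, fun m _ => by simp⟩
  add_mem' {x y} hx hy n := by
    obtain ⟨u, hu⟩ := hx n
    obtain ⟨v, hv⟩ := hy n
    exact ⟨u + v, fun m hm => by rw [Pi.add_apply, hu m hm, hv m hm, map_add]⟩
  neg_mem' {x} hx n := by
    obtain ⟨u, hu⟩ := hx n
    exact ⟨-u, fun m hm => by rw [Pi.neg_apply, hu m hm, map_neg]⟩

/-- The canonical map `R_p → R̂_p`. -/
def toCompl (p : ℤ) (u : 𝒜 p) : complPiece 𝒜 p :=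
  ⟨fun n => gq 𝒜 n p u, fun _ => ⟨u, fun _ _ => rfl⟩⟩

/-- The neighbourhood `N_L^n R̂_p`, the kernel of `R̂_p → R_p / N_L^n R_p`. -/
def complNbhd (n p : ℤ) : AddSubgroup (complPiece 𝒜 p) where
  carrier := {x | x.1 n = 0}
  zero_mem' := rfl
  add_mem' {x y} hx hy := by
    change x.1 n + y.1 n = 0
    rw [show x.1 n = 0 from hx, show y.1 n = 0 from hy, add_zero]
  neg_mem' {x} hx := by
    change - x.1 n = 0
    rw [show x.1 n = 0 from hx, neg_zero]

variable {𝒜}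

/-- `u` represents `x` up to level `n`. -/
def IsRep {p : ℤ} (x : complPiece 𝒜 p) (n : ℤ) (u : 𝒜 p) : Prop := ∀ m ≤ n, x.1 m = gq 𝒜 m p u

theorem exists_isRep {p : ℤ} (x : complPiece 𝒜 p) (n : ℤ) : ∃ u, IsRep x n u := x.2 n

theorem isRep_of_eq {p n : ℤ} {x : complPiece 𝒜 p} {u : 𝒜 p} (h : x.1 n = gq 𝒜 n p u) :
    IsRep x n u := by
  obtain ⟨v, hv⟩ := exists_isRep x n
  intro m hm
  rw [hv m hm, gq_eq]
  rw [hv n le_rfl, gq_eq] at h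
  exact gradedNbhd_anti hm p h

theorem IsRep.mono {p m n : ℤ} {x : complPiece 𝒜 p} {u : 𝒜 p} (h : IsRep x n u) (hm : m ≤ n) :
    IsRep x m u := fun k hk => h k (hk.trans hm)

theorem IsRep.add {p n : ℤ} {x y : complPiece 𝒜 p} {u v : 𝒜 p} (h : IsRep x n u)
    (h' : IsRep y n v) : IsRep (x + y) n (u + v) := fun m hm => by
  rw [map_add, ← h m hm, ← h' m hm]; rfl

theorem isRep_zero {p n : ℤ} : IsRep (0 : complPiece 𝒜 p) n 0 := fun m _ => by
  rw [map_zero]; rfl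

theorem isRep_toCompl {p n : ℤ} (u : 𝒜 p) : IsRep (toCompl 𝒜 p u) n u := fun _ _ => rfl

theorem compl_ext {p : ℤ} {x y : complPiece 𝒜 p} (h : ∀ n, ∃ u, IsRep x n u ∧ IsRep y n u) :
    x = y := by
  apply Subtype.ext
  funext n
  obtain ⟨u, hx, hy⟩ := h n
  rw [hx n le_rfl, hy n le_rfl]

theorem mem_complNbhd {n p : ℤ} {x : complPiece 𝒜 p} {u : 𝒜 p} (h : IsRep x n u) :
    x ∈ complNbhd 𝒜 n p ↔ (u : R) ∈ gradedNbhd 𝒜 n p := by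
  change x.1 n = 0 ↔ _
  rw [h n le_rfl, ← map_zero (gq 𝒜 n p), gq_eq]
  simp

theorem compl_sigma_ext {p q : ℤ} (hpq : p = q) {x : complPiece 𝒜 p} {y : complPiece 𝒜 q}
    (h : ∀ n, ∃ (u : 𝒜 p) (v : 𝒜 q), (u : R) = v ∧ IsRep x n u ∧ IsRep y n v) :
    (GradedMonoid.mk p x : GradedMonoid fun p => complPiece 𝒜 p) = GradedMonoid.mk q y := by
  subst hpq
  congr 1
  refine compl_ext fun n => ?_
  obtain ⟨u, v, huv, hx, hy⟩ := h n
  obtain rfl := Subtype.ext huv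
  exact ⟨u, hx, hy⟩

variable [SetLike.GradedMonoid 𝒜]

theorem gradedNbhd_mul {n p q : ℤ} {x y : R} (hx : x ∈ gradedNbhd 𝒜 n p) (hy : y ∈ 𝒜 q) :
    x * y ∈ gradedNbhd 𝒜 (n - q) (p + q) := by
  induction hx using AddSubgroup.closure_induction with
  | mem x hx =>
    obtain ⟨j, hj, a, ha, b, hb, rfl⟩ := hx
    refine AddSubgroup.subset_closure ⟨j + q, by lia, a, ?_, b * y, SetLike.mul_mem_graded hb hy,
      mul_assoc _ _ _⟩
    rwa [show p + q - (j + q) = p - j by ring]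
  | zero => rw [zero_mul]; exact zero_mem _
  | add _ _ _ _ h h' => rw [add_mul]; exact add_mem h h'
  | neg _ _ h => rw [neg_mul]; exact neg_mem h

theorem mul_gradedNbhd {n p q : ℤ} {x y : R} (hx : x ∈ 𝒜 p) (hy : y ∈ gradedNbhd 𝒜 n q) :
    x * y ∈ gradedNbhd 𝒜 n (p + q) := by
  induction hy using AddSubgroup.closure_induction with
  | mem y hy =>
    obtain ⟨j, hj, a, ha, b, hb, rfl⟩ := hy
    refine AddSubgroup.subset_closure ⟨j, hj, x * a, ?_, b, hb, (mul_assoc _ _ _).symm⟩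
    rw [show p + q - j = p + (q - j) by ring]
    exact SetLike.mul_mem_graded hx ha
  | zero => rw [mul_zero]; exact zero_mem _
  | add _ _ _ _ h h' => rw [mul_add]; exact add_mem h h'
  | neg _ _ h => rw [mul_neg]; exact neg_mem h

/-- The product of elements of `R_p` and `R_q`. -/
def gmul {p q : ℤ} (u : 𝒜 p) (v : 𝒜 q) : 𝒜 (p + q) := ⟨u * v, SetLike.mul_mem_graded u.2 v.2⟩

theorem gq_gmul {n p q : ℤ} {u u' : 𝒜 p} {v v' : 𝒜 q}
    (hu : gq 𝒜 (n + q) p u = gq 𝒜 (n + q) p u') (hv : gq 𝒜 n q v = gq 𝒜 n q v') :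
    gq 𝒜 n (p + q) (gmul u v) = gq 𝒜 n (p + q) (gmul u' v') := by
  rw [gq_eq] at hu hv ⊢
  have h1 := gradedNbhd_mul hu v.2
  have h2 := mul_gradedNbhd u'.2 hv
  rw [add_sub_cancel_right] at h1
  have := add_mem h1 h2
  convert this using 1
  change (u : R) * v - u' * v' = _
  noncomm_ring

/-- The product `R̂_p × R̂_q → R̂_{p+q}`, the extension by continuity of the product of `R`. -/
def complMul {p q : ℤ} (x : complPiece 𝒜 p) (y : complPiece 𝒜 q) : complPiece 𝒜 (p + q) :=
  ⟨fun n => gq 𝒜 n (p + q)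
      (gmul (exists_isRep x (n + q)).choose (exists_isRep y n).choose), fun n => by
    refine ⟨gmul (exists_isRep x (n + q)).choose (exists_isRep y n).choose, fun m hm => ?_⟩
    refine gq_gmul ?_ ?_
    · rw [← (exists_isRep x (m + q)).choose_spec _ le_rfl,
        (exists_isRep x (n + q)).choose_spec _ (by lia)]
    · rw [← (exists_isRep y m).choose_spec _ le_rfl, (exists_isRep y n).choose_spec _ hm]⟩

theorem IsRep.mul {n p q : ℤ} {x : complPiece 𝒜 p} {y : complPiece 𝒜 q} {u : 𝒜 p} {v : 𝒜 q}
    (hu : IsRep x (n + q) u) (hv : IsRep y n v) : IsRep (complMul x y) n (gmul u v) := by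
  intro m hm
  refine gq_gmul ?_ ?_
  · rw [← (exists_isRep x (m + q)).choose_spec _ le_rfl, hu _ (by lia)]
  · rw [← (exists_isRep y m).choose_spec _ le_rfl, hv _ hm]

/-- The unit of `R_0`. -/
def gone : 𝒜 0 := ⟨1, SetLike.one_mem_graded 𝒜⟩

theorem complMul_zero {p q : ℤ} (x : complPiece 𝒜 p) : complMul x (0 : complPiece 𝒜 q) = 0 :=
  compl_ext fun n => by
    obtain ⟨u, hu⟩ := exists_isRep x (n + q)
    refine ⟨0, ?_, isRep_zero⟩
    have h := hu.mul (isRep_zero (𝒜 := 𝒜) (p := q))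
    rwa [show gmul u (0 : 𝒜 q) = 0 from Subtype.ext (mul_zero _)] at h

theorem zero_complMul {p q : ℤ} (y : complPiece 𝒜 q) : complMul (0 : complPiece 𝒜 p) y = 0 :=
  compl_ext fun n => by
    obtain ⟨v, hv⟩ := exists_isRep y n
    refine ⟨0, ?_, isRep_zero⟩
    have h := (isRep_zero (𝒜 := 𝒜) (p := p)).mul hv
    rwa [show gmul (0 : 𝒜 p) v = 0 from Subtype.ext (zero_mul _)] at h

theorem complMul_add {p q : ℤ} (x : complPiece 𝒜 p) (y z : complPiece 𝒜 q) :
    complMul x (y + z) = complMul x y + complMul x z :=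
  compl_ext fun n => by
    obtain ⟨u, hu⟩ := exists_isRep x (n + q)
    obtain ⟨v, hv⟩ := exists_isRep y n
    obtain ⟨w, hw⟩ := exists_isRep z n
    refine ⟨_, hu.mul (hv.add hw), ?_⟩
    rw [show gmul u (v + w) = gmul u v + gmul u w from Subtype.ext (mul_add _ _ _)]
    exact (hu.mul hv).add (hu.mul hw)

theorem add_complMul {p q : ℤ} (x y : complPiece 𝒜 p) (z : complPiece 𝒜 q) :
    complMul (x + y) z = complMul x z + complMul y z :=
  compl_ext fun n => by
    obtain ⟨u, hu⟩ := exists_isRep x (n + q)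
    obtain ⟨v, hv⟩ := exists_isRep y (n + q)
    obtain ⟨w, hw⟩ := exists_isRep z n
    refine ⟨_, (hu.add hv).mul hw, ?_⟩
    rw [show gmul (u + v) w = gmul u w + gmul v w from Subtype.ext (add_mul _ _ _)]
    exact (hu.mul hw).add (hv.mul hw)

instance : GradedMonoid.GMul fun p => complPiece 𝒜 p := ⟨complMul⟩

instance : GradedMonoid.GOne fun p => complPiece 𝒜 p := ⟨toCompl 𝒜 0 gone⟩

instance : DirectSum.GRing fun p => complPiece 𝒜 p where
  mul_zero := complMul_zero
  zero_mul := zero_complMul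
  mul_add := complMul_add
  add_mul := add_complMul
  one_mul a := compl_sigma_ext (zero_add _) fun n => by
    obtain ⟨u, hu⟩ := exists_isRep a.2 n
    exact ⟨_, u, one_mul _, (isRep_toCompl gone).mul hu, hu⟩
  mul_one a := compl_sigma_ext (add_zero _) fun n => by
    obtain ⟨u, hu⟩ := exists_isRep a.2 (n + 0)
    exact ⟨_, u, mul_one _, hu.mul (isRep_toCompl gone), hu.mono (by simp)⟩
  mul_assoc a b c := compl_sigma_ext (add_assoc _ _ _) fun n => by
    obtain ⟨u, hu⟩ := exists_isRep a.2 (n + (b.1 + c.1))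
    obtain ⟨v, hv⟩ := exists_isRep b.2 (n + c.1)
    obtain ⟨w, hw⟩ := exists_isRep c.2 n
    refine ⟨_, _, mul_assoc _ _ _, IsRep.mul (IsRep.mul (hu.mono ?_) hv) hw,
      hu.mul (hv.mul hw)⟩
    lia
  natCast n := n • toCompl 𝒜 0 gone
  natCast_zero := zero_smul _ _
  natCast_succ n := succ_nsmul _ _
  intCast n := n • toCompl 𝒜 0 gone
  intCast_ofNat n := natCast_zsmul _ _
  intCast_negSucc_ofNat n := negSucc_zsmul _ _

variable (𝒜)

/-- The graded completion `R̂ = ⨁_p R̂_p`. -/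
abbrev Compl : Type u := ⨁ p : ℤ, complPiece 𝒜 p

variable {𝒜}

/-- The inclusion `R̂_p ⊆ R̂`. -/
abbrev cof (p : ℤ) : complPiece 𝒜 p →+ Compl 𝒜 := DirectSum.of (fun p => complPiece 𝒜 p) p

theorem cof_mul_cof {p q : ℤ} (x : complPiece 𝒜 p) (y : complPiece 𝒜 q) :
    cof p x * cof q y = cof (p + q) (complMul x y) := by
  have h := DirectSum.of_mul_of (A := fun p => complPiece 𝒜 p) x y
  exact h

theorem complMul_nbhd_left {n p q : ℤ} {x : complPiece 𝒜 p} (hx : x ∈ complNbhd 𝒜 n p)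
    (y : complPiece 𝒜 q) : complMul x y ∈ complNbhd 𝒜 (n - q) (p + q) := by
  obtain ⟨u, hu⟩ := exists_isRep x n
  obtain ⟨v, hv⟩ := exists_isRep y (n - q)
  rw [mem_complNbhd (IsRep.mul (hu.mono (by lia)) hv)]
  exact gradedNbhd_mul ((mem_complNbhd hu).1 hx) v.2

theorem complMul_nbhd_right {n p q : ℤ} (x : complPiece 𝒜 p) {y : complPiece 𝒜 q}
    (hy : y ∈ complNbhd 𝒜 n q) : complMul x y ∈ complNbhd 𝒜 n (p + q) := by
  obtain ⟨u, hu⟩ := exists_isRep x (n + q)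
  obtain ⟨v, hv⟩ := exists_isRep y n
  rw [mem_complNbhd (hu.mul hv)]
  exact mul_gradedNbhd u.2 ((mem_complNbhd hv).1 hy)

theorem complMul_sub_left {p q : ℤ} (x x' : complPiece 𝒜 p) (y : complPiece 𝒜 q) :
    complMul (x - x') y = complMul x y - complMul x' y := by
  rw [eq_sub_iff_add_eq, ← add_complMul, sub_add_cancel]

theorem complMul_sub_right {p q : ℤ} (x : complPiece 𝒜 p) (y y' : complPiece 𝒜 q) :
    complMul x (y - y') = complMul x y - complMul x y' := by
  rw [eq_sub_iff_add_eq, ← complMul_add, sub_add_cancel]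

/-! ### Closed ideals and the quotient -/

/-- The closure of `J ∩ R̂_p` in `R̂_p`. -/
def closurePiece (J : TwoSidedIdeal (Compl 𝒜)) (p : ℤ) : AddSubgroup (complPiece 𝒜 p) where
  carrier := {x | ∀ n, ∃ y : complPiece 𝒜 p, cof p y ∈ J ∧ x - y ∈ complNbhd 𝒜 n p}
  zero_mem' n := ⟨0, by rw [map_zero]; exact J.zero_mem, by rw [sub_zero]; exact zero_mem _⟩
  add_mem' {x x'} hx hx' n := by
    obtain ⟨y, hy, h⟩ := hx n
    obtain ⟨y', hy', h'⟩ := hx' n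
    refine ⟨y + y', by rw [map_add]; exact J.add_mem hy hy', ?_⟩
    rw [add_sub_add_comm]
    exact add_mem h h'
  neg_mem' {x} hx n := by
    obtain ⟨y, hy, h⟩ := hx n
    refine ⟨-y, by rw [map_neg]; exact J.neg_mem hy, ?_⟩
    rw [← neg_sub']
    exact neg_mem h

theorem closurePiece_mul_left (J : TwoSidedIdeal (Compl 𝒜)) {p q : ℤ} (x : complPiece 𝒜 p)
    {y : complPiece 𝒜 q} (hy : y ∈ closurePiece J q) : complMul x y ∈ closurePiece J (p + q) := by
  intro n
  obtain ⟨z, hz, h⟩ := hy n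
  refine ⟨complMul x z, ?_, ?_⟩
  · rw [← cof_mul_cof]; exact J.mul_mem_left _ _ hz
  · rw [← complMul_sub_right]; exact complMul_nbhd_right x h

theorem closurePiece_mul_right (J : TwoSidedIdeal (Compl 𝒜)) {p q : ℤ} {x : complPiece 𝒜 p}
    (y : complPiece 𝒜 q) (hx : x ∈ closurePiece J p) :
    complMul x y ∈ closurePiece J (p + q) := by
  intro n
  obtain ⟨z, hz, h⟩ := hx (n + q)
  refine ⟨complMul z y, ?_, ?_⟩
  · rw [← cof_mul_cof]; exact J.mul_mem_right _ _ hz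
  · rw [← complMul_sub_left]
    have := complMul_nbhd_left h y
    rwa [add_sub_cancel_right] at this

/-- The elements of `R̂` all of whose components lie in the closures of the pieces of `J`. -/
def closureAdd (J : TwoSidedIdeal (Compl 𝒜)) : AddSubgroup (Compl 𝒜) where
  carrier := {x | ∀ p, x p ∈ closurePiece J p}
  zero_mem' _ := zero_mem _
  add_mem' hx hy p := add_mem (hx p) (hy p)
  neg_mem' hx p := neg_mem (hx p)

theorem cof_mem_closureAdd {J : TwoSidedIdeal (Compl 𝒜)} {p : ℤ} {x : complPiece 𝒜 p}
    (hx : x ∈ closurePiece J p) : cof p x ∈ closureAdd J := by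
  intro q
  by_cases h : p = q
  · subst h
    rw [DirectSum.of_eq_same]
    exact hx
  · rw [DirectSum.of_eq_of_ne _ _ _ (Ne.symm h)]
    exact zero_mem _

theorem closureAdd_induction {J : TwoSidedIdeal (Compl 𝒜)} {P : Compl 𝒜 → Prop} {x : Compl 𝒜}
    (hx : x ∈ closureAdd J) (h0 : P 0)
    (h1 : ∀ p, ∀ y ∈ closurePiece J p, P (cof p y)) (h2 : ∀ x y, P x → P y → P (x + y)) : P x := by
  classical
  rw [← DirectSum.sum_support_of x]
  exact Finset.sum_induction _ P h2 h0 fun p _ => h1 p _ (hx p)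

/-- The closure of a two-sided ideal `J` of `R̂`, taken degree by degree. -/
def idealClosure (J : TwoSidedIdeal (Compl 𝒜)) : Ideal (Compl 𝒜) :=
  { closureAdd J with
    smul_mem' := by
      intro c x hx
      change c * x ∈ closureAdd J
      refine closureAdd_induction (P := fun x => c * x ∈ closureAdd J) hx ?_ ?_ ?_
      · rw [mul_zero]; exact zero_mem _
      · intro q y hy
        induction c using DirectSum.induction_on with
        | zero => rw [zero_mul]; exact zero_mem _
        | of p c =>
          rw [cof_mul_cof]
          exact cof_mem_closureAdd (closurePiece_mul_left J c hy)
        | add a b ha hb => rw [add_mul]; exact add_mem ha hb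
      · intro a b ha hb
        rw [mul_add]; exact add_mem ha hb }

theorem mem_idealClosure {J : TwoSidedIdeal (Compl 𝒜)} {x : Compl 𝒜} :
    x ∈ idealClosure J ↔ ∀ p, x p ∈ closurePiece J p := Iff.rfl

instance (J : TwoSidedIdeal (Compl 𝒜)) : (idealClosure J).IsTwoSided where
  mul_mem_of_left {x} c hx := by
    change x * c ∈ closureAdd J
    refine closureAdd_induction (P := fun x => x * c ∈ closureAdd J) hx ?_ ?_ ?_
    · rw [zero_mul]; exact zero_mem _
    · intro q y hy
      induction c using DirectSum.induction_on with
      | zero => rw [mul_zero]; exact zero_mem _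
      | of p c =>
        rw [cof_mul_cof]
        exact cof_mem_closureAdd (closurePiece_mul_right J c hy)
      | add a b ha hb => rw [mul_add]; exact add_mem ha hb
    · intro a b ha hb
      rw [add_mul]; exact add_mem ha hb

variable (J : TwoSidedIdeal (Compl 𝒜))

/-- The quotient of `R̂` by the closure of `J`. -/
abbrev ComplQuot : Type u := Compl 𝒜 ⧸ idealClosure J

/-- The map `R̂_p → R̂ / J̄`. -/
def quotOf (p : ℤ) : complPiece 𝒜 p →+ ComplQuot J :=
  (Ideal.Quotient.mk (idealClosure J)).toAddMonoidHom.comp (cof p)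

/-- The degree `p` part of `R̂ / J̄`, the image of `R̂_p`. -/
def quotDeg (p : ℤ) : AddSubgroup (ComplQuot J) := (quotOf J p).range

/-- The neighbourhoods of the quotient: the images of `N_L^n R̂ = ⨁_p N_L^n R̂_p`. -/
def quotNbhd (n : ℤ) : AddSubgroup (ComplQuot J) :=
  ⨆ p : ℤ, (complNbhd 𝒜 n p).map (quotOf J p)

instance : SetLike.GradedMonoid (quotDeg J) where
  one_mem := ⟨_, rfl⟩
  mul_mem := by
    rintro p q _ _ ⟨x, rfl⟩ ⟨y, rfl⟩
    refine ⟨complMul x y, ?_⟩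
    change Ideal.Quotient.mk _ (cof (p + q) (complMul x y)) = _
    rw [← cof_mul_cof, map_mul]
    rfl

/-- The map `R̂_p → (R̂ / J̄)_p`. -/
def quotToDeg (p : ℤ) : complPiece 𝒜 p →+ quotDeg J p where
  toFun x := ⟨quotOf J p x, x, rfl⟩
  map_zero' := Subtype.ext (map_zero (quotOf J p))
  map_add' x y := Subtype.ext (map_add (quotOf J p) x y)

/-- The decomposition of `R̂ / J̄` into its homogeneous components, on representatives. -/
def quotDecomposeAux : Compl 𝒜 →+ ⨁ p : ℤ, quotDeg J p :=
  DirectSum.toAddMonoid fun p => (DirectSum.of (fun p => quotDeg J p) p).comp (quotToDeg J p)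

theorem quotDecomposeAux_cof (p : ℤ) (x : complPiece 𝒜 p) :
    quotDecomposeAux J (cof p x) = DirectSum.of (fun p => quotDeg J p) p (quotToDeg J p x) := by
  have h := DirectSum.toAddMonoid_of
    (fun p => (DirectSum.of (fun p => quotDeg J p) p).comp (quotToDeg J p)) p x
  exact h

theorem quotOf_eq_zero {p : ℤ} {x : complPiece 𝒜 p} (hx : x ∈ closurePiece J p) :
    quotOf J p x = 0 :=
  Ideal.Quotient.eq_zero_iff_mem.2 (cof_mem_closureAdd hx)

/-- The decomposition of `R̂ / J̄` into its homogeneous components. -/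
def quotDecompose : ComplQuot J →+ ⨁ p : ℤ, quotDeg J p :=
  QuotientAddGroup.lift (idealClosure J).toAddSubgroup (quotDecomposeAux J) (by
    intro x hx
    refine closureAdd_induction (P := fun x => quotDecomposeAux J x = 0) hx (map_zero _) ?_ ?_
    · intro p y hy
      have : quotToDeg J p y = 0 := Subtype.ext (quotOf_eq_zero J hy)
      rw [quotDecomposeAux_cof, this, map_zero]
    · intro a b ha hb
      rw [map_add, ha, hb, add_zero])

theorem quotDecompose_quotOf (p : ℤ) (x : complPiece 𝒜 p) :
    quotDecompose J (quotOf J p x) =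
      DirectSum.of (fun p => quotDeg J p) p (quotToDeg J p x) :=
  quotDecomposeAux_cof J p x

theorem complQuot_induction {P : ComplQuot J → Prop} (x : ComplQuot J) (h0 : P 0)
    (h1 : ∀ p x, P (quotOf J p x)) (h2 : ∀ x y, P x → P y → P (x + y)) : P x := by
  obtain ⟨x, rfl⟩ := Ideal.Quotient.mk_surjective x
  induction x using DirectSum.induction_on with
  | zero => rw [map_zero]; exact h0
  | of p x => exact h1 p x
  | add a b ha hb => rw [map_add]; exact h2 _ _ ha hb

instance : DirectSum.Decomposition (quotDeg J) :=
  DirectSum.Decomposition.ofAddHom (quotDeg J) (quotDecompose J)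
    (by
      ext x
      refine complQuot_induction J (P := fun x => ((DirectSum.coeAddMonoidHom (quotDeg J)).comp
        (quotDecompose J)) x = AddMonoidHom.id _ x) x ?_ ?_ ?_
      · simp
      · intro p x
        rw [AddMonoidHom.comp_apply, quotDecompose_quotOf, DirectSum.coeAddMonoidHom_of]
        rfl
      · intro a b ha hb
        rw [map_add, ha, hb, map_add])
    (by
      refine DirectSum.addHom_ext' fun p => ?_
      ext ⟨_, x, rfl⟩ : 1
      rw [AddMonoidHom.comp_apply, AddMonoidHom.comp_apply, DirectSum.coeAddMonoidHom_of,
        quotDecompose_quotOf]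
      rfl)

instance : GradedRing (quotDeg J) where

theorem mem_quotNbhd_of {n p : ℤ} {x : complPiece 𝒜 p} (hx : x ∈ complNbhd 𝒜 n p) :
    quotOf J p x ∈ quotNbhd J n :=
  (le_iSup (fun p => (complNbhd 𝒜 n p).map (quotOf J p)) p) ⟨x, hx, rfl⟩

theorem decompose_quotOf_same (p : ℤ) (x : complPiece 𝒜 p) :
    (DirectSum.decompose (quotDeg J) (quotOf J p x) p : ComplQuot J) = quotOf J p x :=
  DirectSum.decompose_of_mem_same (quotDeg J) ⟨x, rfl⟩

theorem decompose_quotOf_ne {p q : ℤ} (h : p ≠ q) (x : complPiece 𝒜 p) :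
    (DirectSum.decompose (quotDeg J) (quotOf J p x) q : ComplQuot J) = 0 :=
  DirectSum.decompose_of_mem_ne (quotDeg J) ⟨x, rfl⟩ h

theorem quotNbhd_homog (n : ℤ) (x : ComplQuot J) (hx : x ∈ quotNbhd J n) (p : ℤ) :
    ∃ y ∈ complNbhd 𝒜 n p,
      (DirectSum.decompose (quotDeg J) x p : ComplQuot J) = quotOf J p y := by
  induction hx using AddSubgroup.iSup_induction' with
  | hp q x hx =>
    obtain ⟨y, hy, rfl⟩ := hx
    by_cases h : q = p
    · subst h
      exact ⟨y, hy, decompose_quotOf_same J _ y⟩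
    · exact ⟨0, zero_mem _, by rw [decompose_quotOf_ne J h, map_zero]⟩
  | h1 => exact ⟨0, zero_mem _, by simp⟩
  | hadd x y _ _ h h' =>
    obtain ⟨a, ha, e⟩ := h
    obtain ⟨b, hb, e'⟩ := h'
    refine ⟨a + b, add_mem ha hb, ?_⟩
    rw [DirectSum.decompose_add, map_add, ← e, ← e']
    rfl

theorem quotOf_mul {p q : ℤ} (x : complPiece 𝒜 p) (y : complPiece 𝒜 q) :
    quotOf J p x * quotOf J q y = quotOf J (p + q) (complMul x y) := by
  change Ideal.Quotient.mk _ (cof p x) * Ideal.Quotient.mk _ (cof q y) =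
    Ideal.Quotient.mk _ (cof (p + q) (complMul x y))
  rw [← map_mul, cof_mul_cof]

theorem gradedNbhd_of_nonpos {n p : ℤ} (hn : n ≤ 0) : 𝒜 p ≤ gradedNbhd 𝒜 n p := fun x hx =>
  AddSubgroup.subset_closure ⟨0, by lia, x, by rwa [sub_zero], 1, SetLike.one_mem_graded 𝒜,
    (mul_one x).symm⟩

/-- The quotient of the graded completion of `R` by the closure of `J`, as a graded ring with its
quotient seminorm. -/
def complQuotRing : SeminormedGradedRing.{u} where
  carrier := ComplQuot J
  deg := quotDeg J
  nbhd := quotNbhd J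
  nbhd_anti n := iSup_mono fun p => AddSubgroup.map_mono fun x hx => by
    obtain ⟨u, hu⟩ := exists_isRep x (n + 1)
    rw [mem_complNbhd (hu.mono (by lia))]
    exact gradedNbhd_anti (by lia) p ((mem_complNbhd hu).1 hx)
  nbhd_exhaust x := ⟨0, by
    refine complQuot_induction J (P := fun x => x ∈ quotNbhd J 0) x (zero_mem _) ?_
      fun _ _ => add_mem
    intro p x
    refine mem_quotNbhd_of J ?_
    obtain ⟨u, hu⟩ := exists_isRep x 0
    rw [mem_complNbhd hu]
    exact gradedNbhd_of_nonpos le_rfl u.2⟩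
  nbhd_homog n x hx p := by
    obtain ⟨y, hy, e⟩ := quotNbhd_homog J n x hx p
    rw [e]
    exact mem_quotNbhd_of J hy
  nbhd_mul n p q x y hx hxp hy := by
    obtain ⟨x', hx', e⟩ := quotNbhd_homog J n x hx p
    obtain ⟨y', rfl⟩ := hy
    rw [DirectSum.decompose_of_mem_same (quotDeg J) hxp] at e
    rw [e, quotOf_mul]
    exact mem_quotNbhd_of J (complMul_nbhd_left hx' y')
  mul_nbhd n p q x y hx hy hyq := by
    obtain ⟨y', hy', e⟩ := quotNbhd_homog J n y hy q
    obtain ⟨x', rfl⟩ := hx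
    rw [DirectSum.decompose_of_mem_same (quotDeg J) hyq] at e
    rw [e, quotOf_mul]
    exact mem_quotNbhd_of J (complMul_nbhd_right x' hy')

end Completion

/-! ### Vertex operator algebras -/

section VOA

/-- A vertex operator algebra of CFT type with underlying vector space `V`: `gr n` is `V_n`, `vac` is
the vacuum vector, `omega` the conformal vector, `mode a m` is the endomorphism `a_(m)`, and `charge`
is the central charge. -/
structure VertexOperatorAlgebra (V : Type v) [AddCommGroup V] [Module ℂ V] where
  gr : ℕ → Submodule ℂ V
  vac : V
  omega : V
  mode : V →ₗ[ℂ] (ℤ → Module.End ℂ V)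
  charge : ℂ
  isInternal_gr : DirectSum.IsInternal gr
  finite_gr : ∀ n, Module.Finite ℂ (gr n)
  finrank_gr_zero : Module.finrank ℂ (gr 0) = 1
  vac_mem : vac ∈ gr 0
  omega_mem : omega ∈ gr 2
  /-- Vertex operators are fields. -/
  mode_eventually_zero : ∀ a b : V, ∃ M : ℤ, ∀ m ≥ M, mode a m b = 0
  mode_vac_neg_one : mode vac (-1) = LinearMap.id
  mode_vac_of_ne : ∀ m : ℤ, m ≠ -1 → mode vac m = 0
  mode_neg_one_vac : ∀ a : V, mode a (-1) vac = a
  mode_nonneg_vac : ∀ (a : V) (m : ℤ), 0 ≤ m → mode a m vac = 0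
  /-- Weak commutativity: the coefficient of `z₁^(-m-1) z₂^(-n-1)` in
  `(z₁ - z₂)^N [Y(a,z₁), Y(b,z₂)]` vanishes. -/
  weak_comm : ∀ a b : V, ∃ N : ℕ, ∀ m n : ℤ,
    ∑ i ∈ Finset.range (N + 1), ((-1) ^ i * (N.choose i : ℂ)) •
      (mode a (m + N - i) * mode b (n + i) - mode b (n + i) * mode a (m + N - i)) = 0
  /-- The Virasoro relations. -/
  virasoro : ∀ p q : ℤ,
    mode omega (p + 1) * mode omega (q + 1) - mode omega (q + 1) * mode omega (p + 1) =
      ((p : ℂ) - q) • mode omega (p + q + 1) +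
        (if p + q = 0 then charge / 12 * ((p : ℂ) ^ 3 - p) else 0) •
          (LinearMap.id : Module.End ℂ V)
  omega_one : ∀ (n : ℕ) (a : V), a ∈ gr n → mode omega 1 a = (n : ℂ) • a
  /-- `Y(ω_(0) a, z) = d/dz Y(a, z)`. -/
  mode_omega_zero : ∀ (a : V) (m : ℤ), mode (mode omega 0 a) m = (-m : ℂ) • mode a (m - 1)

namespace VertexOperatorAlgebra

variable {V : Type v} [AddCommGroup V] [Module ℂ V] (A : VertexOperatorAlgebra V)

/-! ### The enveloping algebra `U` of the finite ancillary algebra -/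

/-- The image of `∇ = L_{-1} ⊗ id + id ⊗ d/dt` on `V ⊗ ℂ[t, t⁻¹]`. -/
def imNabla : Submodule ℂ (V ⊗[ℂ] LaurentPolynomial ℂ) :=
  Submodule.span ℂ {x | ∃ (a : V) (i : ℤ),
    x = A.mode A.omega 0 a ⊗ₜ LaurentPolynomial.T i
      + (i : ℂ) • a ⊗ₜ LaurentPolynomial.T (i - 1)}

/-- The vector space `𝔏(V)^f = V ⊗ ℂ[t, t⁻¹] / Im ∇` underlying the finite ancillary Lie algebra. -/
abbrev FinLie : Type v := (V ⊗[ℂ] LaurentPolynomial ℂ) ⧸ A.imNabla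

/-- The class `a_[i]` of `a ⊗ t^i`. -/
def lieMode (a : V) (i : ℤ) : A.FinLie :=
  A.imNabla.mkQ (a ⊗ₜ LaurentPolynomial.T i)

/-- The relations `x y = y x + [x, y]` for `x = a_[i]`, `y = b_[j]` and the Lie bracket
`[a_[i], b_[j]] = ∑_{k ≥ 0} (i choose k) (a_(k) b)_[i+j-k]` of `𝔏(V)^f`. -/
inductive EnvRel : TensorAlgebra ℂ A.FinLie → TensorAlgebra ℂ A.FinLie → Prop
  | comm (a b : V) (i j : ℤ) (M : ℕ) (hM : ∀ k : ℤ, M ≤ k → A.mode a k b = 0) :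
      EnvRel
        (TensorAlgebra.ι ℂ (A.lieMode a i) * TensorAlgebra.ι ℂ (A.lieMode b j))
        (TensorAlgebra.ι ℂ (A.lieMode b j) * TensorAlgebra.ι ℂ (A.lieMode a i) +
          TensorAlgebra.ι ℂ (∑ k ∈ Finset.range M,
            (Ring.choose i k : ℂ) • A.lieMode (A.mode a k b) (i + j - k)))

/-- The universal enveloping algebra `U` of the Lie algebra `𝔏(V)^f`, i.e. the quotient of the tensor
algebra by the relations `x y - y x = [x, y]`. -/
abbrev Env : Type v := RingQuot A.EnvRel

/-- The element `a_[i]` of `U`. -/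
def envMode (a : V) (i : ℤ) : A.Env :=
  RingQuot.mkAlgHom ℂ A.EnvRel (TensorAlgebra.ι ℂ (A.lieMode a i))

/-- `A.IsMonomial d x` says that `x` is a product of elements `a_[i]`, with `a` homogeneous, of total
degree `d`, where `a_[i]` has degree `deg a - i - 1`. -/
inductive IsMonomial : ℤ → A.Env → Prop
  | one : IsMonomial 0 1
  | mul (q : ℕ) (a : V) (ha : a ∈ A.gr q) (i d : ℤ) (x : A.Env) (hx : IsMonomial d x) :
      IsMonomial ((q - i - 1) + d) (A.envMode a i * x)

/-- The degree `d` part `U_d` of `U`. -/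
def envSpan (d : ℤ) : Submodule ℂ A.Env := Submodule.span ℂ {x | A.IsMonomial d x}

/-- The degree `d` part `U_d` of `U`, as an additive subgroup. -/
def envDeg (d : ℤ) : AddSubgroup A.Env := (A.envSpan d).toAddSubgroup

variable {A} in
theorem IsMonomial.mul_mem {d e : ℤ} {x y : A.Env} (hx : A.IsMonomial d x)
    (hy : A.IsMonomial e y) : A.IsMonomial (d + e) (x * y) := by
  induction hx with
  | one => rwa [zero_add, one_mul]
  | mul q a ha i d x _ ih =>
    rw [add_assoc, mul_assoc]
    exact IsMonomial.mul q a ha i _ _ ih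

instance : SetLike.GradedMonoid A.envDeg where
  one_mem := Submodule.subset_span IsMonomial.one
  mul_mem := by
    intro d e x y hx hy
    change x * y ∈ A.envSpan (d + e)
    have h : A.envSpan d * A.envSpan e ≤ A.envSpan (d + e) := by
      rw [envSpan, envSpan, Submodule.span_mul_span, Submodule.span_le]
      rintro _ ⟨x, hx, y, hy, rfl⟩
      exact Submodule.subset_span (IsMonomial.mul_mem hx hy)
    exact h (Submodule.mul_mem_mul hx hy)

/-! ### The universal enveloping algebra of `V` -/

/-- The partial sums
`∑_{i < M} (-1)^i (ℓ choose i) (a_[m+ℓ-i] b_[n+i] - (-1)^ℓ b_[n+ℓ-i] a_[m+i])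
  - ∑_{i < M} (m choose i) (a_(ℓ+i) b)_[m+n-i]`
of the difference of the two sides of the Jacobi identity. -/
def jacobiSum (a b : V) (l m n : ℤ) (M : ℕ) : A.Env :=
  ∑ i ∈ Finset.range M, ((-1) ^ i * (Ring.choose l i : ℂ)) •
      (A.envMode a (m + l - i) * A.envMode b (n + i)
        - ((-1 : ℂ) ^ l) • (A.envMode b (n + l - i) * A.envMode a (m + i)))
    - ∑ i ∈ Finset.range M, (Ring.choose m i : ℂ) •
        A.envMode (A.mode a (l + i) b) (m + n - i)

/-- `A.IsJacobi d x` says that `x ∈ Û_d` is the sum of the (convergent) series given by the difference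
of the two sides of the Jacobi identity, for some homogeneous `a`, `b`. -/
def IsJacobi (d : ℤ) (x : complPiece A.envDeg d) : Prop :=
  ∃ (p q : ℕ) (a b : V) (l m n : ℤ), a ∈ A.gr p ∧ b ∈ A.gr q ∧ d = p + q - l - m - n - 2 ∧
    ∀ k : ℤ, ∀ᶠ M in Filter.atTop, ∃ u : A.envDeg d,
      (u : A.Env) = A.jacobiSum a b l m n M ∧ x.1 k = gq A.envDeg k d u

theorem envMode_mem {q : ℕ} {a : V} (ha : a ∈ A.gr q) {i d : ℤ} (h : d = q - i - 1) :
    A.envMode a i ∈ A.envDeg d := by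
  refine Submodule.subset_span ?_
  have := IsMonomial.mul q a ha i 0 1 IsMonomial.one
  rwa [mul_one, add_zero, ← h] at this

/-- The scalar `c ∈ ℂ` as an element of `U_0`. -/
def envScalar (c : ℂ) : A.envDeg 0 :=
  ⟨algebraMap ℂ A.Env c, by
    rw [Algebra.algebraMap_eq_smul_one]
    exact (A.envSpan 0).smul_mem c (Submodule.subset_span IsMonomial.one)⟩

/-- The element `1_[-1]` of `U_0`. -/
def envVac : A.envDeg 0 := ⟨A.envMode A.vac (-1), A.envMode_mem A.vac_mem (by norm_num)⟩

/-- The element `L_0 = ω_[1]` of `U_0`. -/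
def envL0 : A.envDeg 0 := ⟨A.envMode A.omega 1, A.envMode_mem A.omega_mem (by norm_num)⟩

/-- The two-sided ideal of `Û` generated by the Jacobi relations and the relation `1_[-1] = 1`. -/
def jacobiIdeal : TwoSidedIdeal (Compl A.envDeg) :=
  TwoSidedIdeal.span
    ({z | ∃ (d : ℤ) (x : complPiece A.envDeg d), A.IsJacobi d x ∧ z = cof d x} ∪
      {cof 0 (toCompl A.envDeg 0 A.envVac) - 1})

/-- The (finite) universal enveloping algebra `𝒰 = Û / J̄` of `V`, as a graded ring with its seminorm. -/
def univEnv : SeminormedGradedRing.{v} := complQuotRing A.jacobiIdeal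

/-- The image in `𝒰_0` of an element of `U_0`. -/
def toUnivEnv (u : A.envDeg 0) : A.univEnv.deg 0 :=
  quotToDeg A.jacobiIdeal 0 (toCompl A.envDeg 0 u)

/-- The element `L_0` of `𝒰_0`. -/
def opL0 : A.univEnv.deg 0 := A.toUnivEnv A.envL0

/-- The scalar `c ∈ ℂ` as an element of `𝒰_0`. -/
def scalar (c : ℂ) : A.univEnv.deg 0 := A.toUnivEnv (A.envScalar c)

/-- `c` is an eigenvalue of `L_0` on the subspace `Z` of a `𝒰`-module. -/
def IsL0Eigenvalue {M : Type*} [AddCommGroup M] [Module A.univEnv.carrier M]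
    (Z : Submodule A.univEnv.carrier M) (c : ℂ) : Prop :=
  ∃ z ∈ Z, z ≠ 0 ∧
    (A.opL0 : A.univEnv.carrier) • z = (A.scalar c : A.univEnv.carrier) • z

end VertexOperatorAlgebra

end VOA

end ModeAlg

end

namespace ModeAlg

/-! Everything rests on one observation (`exists_star_eq_smul`). If `α ∈ U_d`, `u ∈ U_0`, `β ∈
U_{-d}`, then on a degree `d` element `γ ⊗ m` of an induced module the factor `βγ` has degree `0`
and can be moved across the tensor sign. So `α ⊗ [u]_0 ⊗ β` acts as left multiplication by `αuβ ∈
U_d U_{-d}`, a representative of its image under `μ_d`. Since `(N^{d+1} U_0) U_d ⊆ N^1 U`, only the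
class in `A_d` matters for this action (`smul_phiLDeg_eq_zero`).

For (a), `𝔄_d` itself lies in the degree `d` part of `Φ^L(Φ^R(A_0))`. Hence `μ_d` is multiplicative,
and an element of its kernel multiplies `𝔄_d` to zero from the left; when there is an identity, that
element is zero. Exactness in the middle is the almost canonical condition: `N^d U_0` is spanned
modulo `N^{d+1} U_0` by the products `U_{-j} U_j` with `j ≤ -d`. Those with `j < -d` lie in `N^{d+1}
U_0` and those with `j = -d` are values of `μ_d`. An identity of `𝔄_d` then gives a central
idempotent of `A_d` that generates `ker π_d`, which splits the sequence; iteration ends at `A_{-1} =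
0`.

For a vertex operator algebra it remains to see that the quotient of the completion is almost
canonical (`almostCanonical_complQuotRing`): an element of `N^n` is approximated to order `n+1` by
an element of the uncompleted ring, and that element is a finite sum of products of the required
kind.

For (b), let `z ≠ 0` lie in `Z`, with leading part `w` of degree `d`. The strong identity acts on
`w` as an element of `U_d U_{-d}`, so `U_{-d}` cannot annihilate `z`; as negative degrees vanish,
some `βz` is a non-zero element of degree `0` in `Z`. There `L_0` acts by `c_W`, so `c_W` is an
eigenvalue on `Z`, and the difference `0` is not positive. -/

/-! ### Splitting off an ideal with an identity element. -/

/-- An ideal with an identity element splits off as a direct factor. -/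
theorem exists_ringEquiv_prod_of_exact {M R S : Type*} [NonUnitalRing M] [Ring R] [Ring S]
    (i : M →+ R) (hi : ∀ x y, i (x * y) = i x * i y) (hinj : Function.Injective i)
    (π : R →+* S) (hπ : Function.Surjective π) (hex : Function.Exact i π)
    (e : M) (he : ∀ x, e * x = x ∧ x * e = x) :
    ∃ f : R ≃+* M × S, (∀ x, f (i x) = (x, 0)) ∧ ∀ a, (f a).2 = π a := by
  -- The image of `i` is the two-sided ideal `ker π`, so it contains `a * i e` and `i e * a`.
  have hmem (a : R) : ∃ m, i m = a * i e :=
    (hex _).1 (by rw [map_mul, (hex (i e)).2 ⟨e, rfl⟩, mul_zero])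
  have hmem' (a : R) : ∃ m, i m = i e * a :=
    (hex _).1 (by rw [map_mul, (hex (i e)).2 ⟨e, rfl⟩, zero_mul])
  -- Both sides equal `i e * a * i e`, because `e` is a two-sided identity of the ideal; thus `i e`
  -- is a central idempotent.
  have hcomm (a : R) : i e * a = a * i e := by
    obtain ⟨m, hm⟩ := hmem a
    obtain ⟨m', hm'⟩ := hmem' a
    have h1 : i e * (a * i e) = a * i e := by rw [← hm, ← hi, (he m).1]
    have h2 : i e * a * i e = i e * a := by rw [← hm', ← hi, (he m').2]
    rw [← h2, mul_assoc, h1]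
  choose j hj using hmem
  let f : R →ₙ+* M × S :=
    { toFun := fun a => (j a, π a)
      map_mul' := fun a b => by
        refine Prod.ext (hinj ?_) (map_mul π a b)
        change i (j (a * b)) = i (j a * j b)
        rw [hi, hj, hj, hj, mul_assoc a (i e), ← mul_assoc (i e) b, hcomm b, mul_assoc b, ← hi,
          (he e).1, mul_assoc]
      map_zero' := by
        refine Prod.ext (hinj ?_) (map_zero π)
        change i (j 0) = i 0
        rw [hj, map_zero, zero_mul]
      map_add' := fun a b => by
        refine Prod.ext (hinj ?_) (map_add π a b)
        change i (j (a + b)) = i (j a + j b)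
        rw [map_add, hj, hj, hj, add_mul] }
  have hfi (x : M) : f (i x) = (x, 0) := by
    refine Prod.ext (hinj ?_) ((hex _).2 ⟨x, rfl⟩)
    change i (j (i x)) = i x
    rw [hj, ← hi, (he x).2]
  refine ⟨RingEquiv.ofBijective f ⟨?_, ?_⟩, hfi, fun a => rfl⟩
  · rw [injective_iff_map_eq_zero]
    intro a ha
    obtain ⟨m, rfl⟩ := (hex a).1 (congrArg Prod.snd ha)
    rw [hfi] at ha
    rw [show m = 0 from congrArg Prod.fst ha, map_zero]
  · rintro ⟨m, s⟩
    obtain ⟨a, rfl⟩ := hπ s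
    obtain ⟨m', hm'⟩ : ∃ m', f a = (m', π a) := ⟨_, rfl⟩
    -- Adding an element of the image of `i` corrects the first coordinate without changing the
    -- second.
    refine ⟨i (m - m') + a, ?_⟩
    rw [map_add, hfi, hm']
    simp

namespace SeminormedGradedRing

variable {U : SeminormedGradedRing.{u}}

/-! ### Almost canonical seminorms -/

/-- This is the easy half of the almost canonical condition. The other half, generation of `N^n`
modulo `N^{n+1}`, enters only in the exactness of the sequence. -/
theorem AlmostCanonical.canonicalNbhd_inf_le (hU : U.AlmostCanonical) (n p : ℤ) :
    U.canonicalNbhd n ⊓ U.deg p ≤ U.nbhd n := by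
  have h := hU n p
  exact (le_sup_left.trans h.ge).trans inf_le_left

theorem AlmostCanonical.mul_mem_nbhd (hU : U.AlmostCanonical) {n p q : ℤ} {x y : U.carrier}
    (hx : x ∈ U.deg p) (hy : y ∈ U.deg q) (hq : q ≤ -n) : x * y ∈ U.nbhd n :=
  hU.canonicalNbhd_inf_le n (p + q)
    ⟨AddSubgroup.subset_closure ⟨x, y, q, hq, hy, rfl⟩, SetLike.mul_mem_graded hx hy⟩

theorem AlmostCanonical.mem_nbhd (hU : U.AlmostCanonical) {n q : ℤ} {y : U.carrier}
    (hy : y ∈ U.deg q) (hq : q ≤ -n) : y ∈ U.nbhd n := by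
  have h := hU.mul_mem_nbhd (SetLike.GradedOne.one_mem (A := U.deg)) hy hq
  rwa [one_mul] at h

/-- The left factors in `canonicalNbhd` are not assumed homogeneous. For `y ∈ U_j` the degree `p`
component of `x y` is `x_{p-j} y`, so homogeneous left factors suffice in a fixed degree. -/
theorem comp_canonicalNbhd {n : ℤ} {z : U.carrier} (hz : z ∈ U.canonicalNbhd n) (p : ℤ) :
    (U.comp p z : U.carrier) ∈
      AddSubgroup.closure {z | ∃ j ≤ -n, ∃ x ∈ U.deg (p - j), ∃ y ∈ U.deg j, z = x * y} := by
  induction hz using AddSubgroup.closure_induction with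
  | mem z hz =>
    obtain ⟨x, y, j, hj, hy, rfl⟩ := hz
    rw [comp_right hy x (p := p - j) (by ring)]
    exact AddSubgroup.subset_closure ⟨j, hj, _, (U.comp (p - j) x).2, y, hy, rfl⟩
  | zero => rw [map_zero]; exact zero_mem _
  | add _ _ _ _ h h' => rw [map_add]; exact add_mem h h'
  | neg _ _ h => rw [map_neg]; exact neg_mem h

theorem zhuMk_eq_zero_iff {d : ℤ} {u : U.deg 0} :
    U.zhuMk d u = 0 ↔ (u : U.carrier) ∈ U.nbhd (d + 1) :=
  Ideal.Quotient.eq_zero_iff_mem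

theorem zhuProj_surjective (d : ℤ) : Function.Surjective (U.zhuProj d) := fun a => by
  obtain ⟨u, rfl⟩ := U.zhuMk_surjective _ a
  exact ⟨U.zhuMk d u, zhuProj_mk U d u⟩

/-! ### Elements of `𝔄_d` as elements of `U_d U_{-d}` -/

variable (U) in
/-- The additive subgroup `U_d U_{-d}` of `U`. -/
def degMulNeg (d : ℤ) : AddSubgroup U.carrier :=
  AddSubgroup.closure {z | ∃ α ∈ U.deg d, ∃ β ∈ U.deg (-d), z = α * β}

theorem degMulNeg_le (d : ℤ) : U.degMulNeg d ≤ U.deg 0 := by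
  rw [degMulNeg, AddSubgroup.closure_le]
  rintro _ ⟨α, hα, β, hβ, rfl⟩
  have := SetLike.mul_mem_graded hα hβ
  rwa [add_neg_cancel] at this

/-- This is what makes `π_d ∘ μ_d` vanish, since `A_{d-1} = U_0 / N^d U_0`. -/
theorem AlmostCanonical.degMulNeg_le_nbhd (hU : U.AlmostCanonical) (d : ℤ) :
    U.degMulNeg d ≤ U.nbhd d := by
  rw [degMulNeg, AddSubgroup.closure_le]
  rintro _ ⟨α, hα, β, hβ, rfl⟩
  exact hU.mul_mem_nbhd hα hβ le_rfl

theorem star_neg {W : Type w} [AddCommGroup W] [Module (U.Zhu 0) W] (x : U.MTA) (y : U.PhiL W) :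
    star x (-y) = -star x y := by
  simp [star]

/-- Right multiplication by `γ ∈ U_d` lowers the neighbourhood index by `d`, so `rγ ∈ N^1 U`, which
is zero in the induced module. Hence `U_0` acts on the degree `d` part through `A_d`. -/
theorem smul_phiLDeg_eq_zero {W : Type w} [AddCommGroup W] [Module (U.Zhu 0) W] {d : ℤ}
    {r : U.carrier} (hr : r ∈ U.deg 0) (hr' : r ∈ U.nbhd (d + 1)) {y : U.PhiL W}
    (hy : y ∈ U.phiLDeg W d) : r • y = 0 := by
  induction hy using AddSubgroup.closure_induction with
  | mem y hy =>
    obtain ⟨γ, hγ, m, rfl⟩ := hy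
    rw [smul_phiLTmul]
    refine phiLTmul_nbhd ?_ m
    have := U.nbhd_mul _ _ _ _ _ hr' hr hγ
    rwa [add_sub_cancel_left] at this
  | zero => rw [smul_zero]
  | add _ _ _ _ h h' => rw [smul_add, h, h', add_zero]
  | neg y _ h => rw [smul_neg, h, neg_zero]

/-- An element of `𝔄_{d,-d}` acts on the degree `d` part of any induced module as an element of
`U_d U_{-d}` that represents its image under `μ_d`. -/
theorem exists_star_eq_smul {d : ℤ} {x : U.MTA} (hx : x ∈ U.mtaBideg d (-d)) :
    ∃ r : U.deg 0, (r : U.carrier) ∈ U.degMulNeg d ∧ muFull d x = U.zhuMk d r ∧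
      ∀ (W : Type w) [AddCommGroup W] [Module (U.Zhu 0) W], ∀ y ∈ U.phiLDeg W d,
        star x y = (r : U.carrier) • y := by
  induction hx using AddSubgroup.closure_induction with
  | mem x hx =>
    obtain ⟨α, hα, a, β, hβ, rfl⟩ := hx
    obtain ⟨u, rfl⟩ := U.zhuMk_surjective _ a
    have hmem : α * ((u : U.carrier) * β) ∈ U.degMulNeg d := by
      refine AddSubgroup.subset_closure ⟨α, hα, _, ?_, rfl⟩
      have := SetLike.mul_mem_graded u.2 hβ
      rwa [zero_add] at this
    refine ⟨⟨_, degMulNeg_le d hmem⟩, hmem, ?_, ?_⟩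
    · change U.zhuMk d (U.comp 0 (U.comp d α * (u * U.comp (-d) β))) = _
      congr 1
      apply Subtype.ext
      rw [comp_of_mem hα, comp_of_mem hβ, comp_of_mem (degMulNeg_le d hmem)]
    · intro W _ _ y hy
      induction hy using AddSubgroup.closure_induction with
      | mem y hy =>
        obtain ⟨γ, hγ, m, rfl⟩ := hy
        have hβγ : β * γ ∈ U.deg 0 := by
          have := SetLike.mul_mem_graded hβ hγ
          rwa [neg_add_cancel] at this
        have ho : U.ostar β γ = U.zhuMk 0 ⟨β * γ, hβγ⟩ :=
          congrArg (U.zhuMk 0) (Subtype.ext (comp_of_mem hβγ))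
        -- First `u`, then `βγ ∈ U_0`, moves from the module factor back into the left factor,
        -- turning `α ⊗ [u]_0 [βγ]_0 m` into `αuβγ ⊗ m`.
        rw [star_tmul, smul_phiLTmul, ho, ← phiLTmul_mul, ← phiLTmul_mul]
        simp only [mul_assoc]
      | zero => rw [star_zero, smul_zero]
      | add _ _ _ _ h h' => rw [star_add, smul_add, h, h']
      | neg y _ h =>
        rw [smul_neg, ← h, star_neg]
  | zero => exact ⟨0, zero_mem _, by simp, fun W _ _ y _ => by rw [zero_star]; simp⟩
  | add x x' _ _ h h' =>
    obtain ⟨r, h1, h2, h3⟩ := h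
    obtain ⟨r', h1', h2', h3'⟩ := h'
    refine ⟨r + r', add_mem h1 h1', by rw [map_add, map_add, h2, h2'], fun W _ _ y hy => ?_⟩
    rw [add_star, h3 W y hy, h3' W y hy, AddSubgroup.coe_add, add_smul]
  | neg x _ h =>
    obtain ⟨r, h1, h2, h3⟩ := h
    refine ⟨-r, neg_mem h1, by rw [map_neg, map_neg, h2], fun W _ _ y hy => ?_⟩
    rw [AddSubgroup.coe_neg, neg_smul, ← h3 W y hy]
    exact map_neg (starHom y) x

/-! ### Multiplicativity and injectivity of `μ_d`. -/

/-- The product of `𝔄` is the action of `𝔄` on `Φ^L(Φ^R(A_0))`; this inclusion lets facts about the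
action on degree `d` parts apply to products in `𝔄_d`. -/
theorem mtaBideg_le_phiLDeg (p q : ℤ) : U.mtaBideg p q ≤ U.phiLDeg U.PhiRZhu p := by
  refine AddSubgroup.closure_mono ?_
  rintro _ ⟨α, hα, a, β, -, rfl⟩
  exact ⟨α, hα, _, rfl⟩

/-- Left multiplication by an element of `𝔄_d` on `𝔄_d` depends only on its image under `μ_d`. -/
theorem mta_mul_eq_zero {d : ℤ} {x y : U.MTA} (hx : x ∈ U.mtaBideg d (-d))
    (hy : y ∈ U.mtaBideg d (-d)) (h : muFull d x = 0) : x * y = 0 := by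
  obtain ⟨r, -, h2, h3⟩ := exists_star_eq_smul.{u, u} hx
  rw [h, eq_comm, zhuMk_eq_zero_iff] at h2
  change star (W := U.PhiRZhu) x y = 0
  rw [h3 _ y (mtaBideg_le_phiLDeg _ _ hy)]
  exact smul_phiLDeg_eq_zero r.2 h2 (mtaBideg_le_phiLDeg _ _ hy)

/-- The map `μ_d` on `𝔄`, regarded as the induced module `Φ^L(Φ^R(A_0))`. -/
def muPhiL (d : ℤ) : U.PhiL U.PhiRZhu →+ U.Zhu d := muFull d

/-- Left multiplication by a degree `0` element commutes with taking homogeneous components, so `r`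
can be pulled out of `[rαuβ]_d`. -/
theorem muPhiL_smul {d : ℤ} (r : U.deg 0) {y : U.PhiL U.PhiRZhu} (hy : y ∈ U.mtaBideg d (-d)) :
    muPhiL d ((r : U.carrier) • y) =
      U.zhuMk d r * muPhiL d y := by
  -- The same subgroup, viewed in `Φ^L(Φ^R(A_0))`, where scalar multiplication by `U` is defined.
  have hy' : y ∈ AddSubgroup.closure {x : U.PhiL U.PhiRZhu | ∃ α ∈ U.deg d, ∃ (a : U.Zhu 0),
    ∃ β ∈ U.deg (-d), x = U.mtaTmul α a β} := hy
  clear hy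
  induction hy' using AddSubgroup.closure_induction with
  | mem y hy =>
    obtain ⟨α, hα, a, β, hβ, rfl⟩ := hy
    obtain ⟨u, rfl⟩ := U.zhuMk_surjective _ a
    change U.zhuMk d (U.comp 0 (U.comp d (r * α) * (u * U.comp (-d) β))) =
      U.zhuMk d r * U.zhuMk d (U.comp 0 (U.comp d α * (u * U.comp (-d) β)))
    rw [← map_mul]
    congr 1
    apply Subtype.ext
    rw [comp_left r.2 α (zero_add d), mul_assoc, comp_left r.2 _ (zero_add 0)]
    rfl
  | zero => rw [smul_zero, map_zero, mul_zero]
  | add x y _ _ h h' => rw [smul_add, map_add, map_add, mul_add, h, h']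
  | neg y _ h => rw [smul_neg, map_neg, map_neg, mul_neg, h]

/-- The map `μ_d` is multiplicative. -/
theorem mu_mul (d : ℕ) (x y : U.MTAd d) : U.mu d (x * y) = U.mu d x * U.mu d y := by
  obtain ⟨r, -, h2, h3⟩ := exists_star_eq_smul.{u, u} x.2
  change muPhiL d (star x.1 (y.1 : U.PhiL U.PhiRZhu)) =
    muFull (d : ℤ) x.1 * muPhiL d (y.1 : U.PhiL U.PhiRZhu)
  rw [h3 _ _ (mtaBideg_le_phiLDeg _ _ y.2), h2, muPhiL_smul r y.2]

/-- For `x` in the kernel, `x = x * e`, and left multiplication by `x` is zero on `𝔄_d`. -/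
theorem mu_injective (d : ℕ) (h : U.HasIdentity d) : Function.Injective (U.mu d) := by
  obtain ⟨e, he⟩ := h
  rw [injective_iff_map_eq_zero]
  intro x hx
  rw [← (he x).2]
  exact Subtype.ext (mta_mul_eq_zero x.2 e.2 hx)

/-! ### Exactness at `A_d`. -/

theorem AlmostCanonical.exact_mu_zhuProj (hU : U.AlmostCanonical) (d : ℕ) :
    Function.Exact (U.mu d) (U.zhuProj d) := by
  intro a
  constructor
  · intro ha
    obtain ⟨u, rfl⟩ := U.zhuMk_surjective _ a
    rw [zhuProj_mk, zhuMk_eq_zero_iff, sub_add_cancel] at ha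
    have hu : (u : U.carrier) ∈ U.nbhd d ⊓ U.deg 0 := ⟨ha, u.2⟩
    rw [hU d 0] at hu
    obtain ⟨z, ⟨hz, hz0⟩, y, ⟨hy, hy0⟩, hzy⟩ := AddSubgroup.mem_sup.1 hu
    -- The summand `y ∈ N^{d+1} U_0` vanishes in `A_d`, leaving the part `z` from the canonical
    -- neighbourhood.
    have hu' : U.zhuMk d u = U.zhuMk d (U.comp 0 z) := by
      rw [← sub_eq_zero, ← map_sub]
      refine zhuMk_eq_zero _ ?_
      rw [AddSubgroup.coe_sub, comp_of_mem hz0, ← hzy, add_sub_cancel_left]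
      exact hy
    rw [hu']
    have key : ∀ z ∈ AddSubgroup.closure
        {z | ∃ j ≤ -(d : ℤ), ∃ x ∈ U.deg (0 - j), ∃ y ∈ U.deg j, z = x * y},
        U.zhuMk d (U.comp 0 z) ∈ (U.mu d).range := by
      intro z hz
      induction hz using AddSubgroup.closure_induction with
      | mem z hz =>
        obtain ⟨j, hj, x, hx, y, hy, rfl⟩ := hz
        have h0 : x * y ∈ U.deg 0 := by
          have := SetLike.mul_mem_graded hx hy
          rwa [sub_add_cancel] at this
        -- For `j = -d` the product `x y` is the value of `μ_d` at `x ⊗ 1 ⊗ y`; for `j < -d` it lies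
        -- in `N^{d+1} U_0` and has class zero.
        rcases hj.eq_or_lt with rfl | hj
        · have hx' : x ∈ U.deg d := by rwa [zero_sub, neg_neg] at hx
          have hm : U.mtaTmul x (U.zhuMk 0 1) y ∈ U.MTAd d :=
            AddSubgroup.subset_closure ⟨x, hx', _, y, hy, rfl⟩
          refine ⟨⟨_, hm⟩, ?_⟩
          have h0' : x * ((1 : U.deg 0) : U.carrier) * y ∈ U.deg 0 := by
            rw [SetLike.GradeZero.coe_one, mul_one]; exact h0
          rw [mu_tmul U d ⟨x, hx'⟩ 1 ⟨y, hy⟩ hm h0']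
          congr 1
          apply Subtype.ext
          rw [comp_of_mem h0]
          simp
        · rw [zhuMk_eq_zero]
          · exact zero_mem _
          · rw [comp_of_mem h0]
            exact hU.mul_mem_nbhd hx hy (by lia)
      | zero => rw [map_zero, map_zero]; exact zero_mem _
      | add _ _ _ _ h h' => rw [map_add, map_add]; exact add_mem h h'
      | neg _ _ h => rw [map_neg, map_neg]; exact neg_mem h
    have := key _ (comp_canonicalNbhd hz 0)
    rwa [show U.comp 0 (U.comp 0 z : U.carrier) = U.comp 0 z from
      Subtype.ext (comp_of_mem (U.comp 0 z).2)] at this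
  · rintro ⟨x, rfl⟩
    obtain ⟨r, h1, h2, -⟩ := exists_star_eq_smul.{u, u} x.2
    rw [show U.mu d x = U.zhuMk d r from h2, zhuProj_mk]
    refine zhuMk_eq_zero _ ?_
    rw [sub_add_cancel]
    exact hU.degMulNeg_le_nbhd d h1

/-! ### The ring splitting and its iteration. -/

theorem AlmostCanonical.splitsAsProduct (hU : U.AlmostCanonical) (d : ℕ) (h : U.HasIdentity d) :
    U.SplitsAsProduct d := by
  obtain ⟨e, he⟩ := id h
  exact exists_ringEquiv_prod_of_exact (U.mu d) (mu_mul d) (mu_injective d h) (U.zhuProj d)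
    (zhuProj_surjective _) (hU.exact_mu_zhuProj d) e he

/-- For `d + 1 ≤ 0` all of `U_0` lies in `N^{d+1} U`. The case `d = -1` starts the iteration. -/
theorem AlmostCanonical.subsingleton_zhu (hU : U.AlmostCanonical) {d : ℤ} (hd : d < 0) :
    Subsingleton (U.Zhu d) := by
  refine subsingleton_of_forall_eq 0 fun a => ?_
  obtain ⟨u, rfl⟩ := U.zhuMk_surjective _ a
  exact zhuMk_eq_zero _ (hU.mem_nbhd u.2 (by lia))

/-- Appending a last factor to a finite product of rings. -/
def snocRingEquiv {n : ℕ} (M : Fin (n + 1) → Type*) [∀ i, NonUnitalNonAssocRing (M i)] :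
    (M (Fin.last n) × ∀ i : Fin n, M i.castSucc) ≃+* ∀ i, M i :=
  { Fin.snocEquiv M with
    map_mul' := fun x y => by
      funext i
      refine Fin.lastCases ?_ (fun i => ?_) i <;> simp [Fin.snocEquiv]
    map_add' := fun x y => by
      funext i
      refine Fin.lastCases ?_ (fun i => ?_) i <;> simp [Fin.snocEquiv] }

/-- The index is shifted by one so that the induction starts at `A_{-1} = 0` with the empty product;
each step splits `A_n` as `𝔄_n × A_{n-1}`. -/
theorem AlmostCanonical.nonempty_zhu_ringEquiv_pi (hU : U.AlmostCanonical) (n : ℕ)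
    (h : ∀ j < n, U.HasIdentity j) : Nonempty (U.Zhu (n - 1) ≃+* ∀ j : Fin n, U.MTAd j) := by
  induction n with
  | zero =>
    have := hU.subsingleton_zhu (d := (0 : ℕ) - 1) (by norm_num)
    exact ⟨{ toFun := fun _ j => j.elim0
             invFun := fun _ => 0
             left_inv := fun _ => Subsingleton.elim _ _
             right_inv := fun _ => Subsingleton.elim _ _
             map_mul' := fun _ _ => Subsingleton.elim _ _
             map_add' := fun _ _ => Subsingleton.elim _ _ }⟩
  | succ n ih =>
    obtain ⟨f⟩ := ih fun j hj => h j (hj.trans n.lt_succ_self)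
    obtain ⟨e, -, -⟩ := hU.splitsAsProduct n (h n n.lt_succ_self)
    rw [show ((n + 1 : ℕ) : ℤ) - 1 = n by push_cast; ring]
    exact ⟨(e.trans (RingEquiv.prodCongr (RingEquiv.refl _) f)).trans
      (snocRingEquiv fun j : Fin (n + 1) => U.MTAd j)⟩

/-! ### Strong identity elements and submodules of induced modules -/

section Submodules

variable {W : Type w} [AddCommGroup W] [Module (U.Zhu 0) W]

/-- The action changes the module factor only by scalars from `A_0`, so it is natural in
`A_0`-linear maps. This transfers identities on `Φ^L(A_0)` to every `Φ^L(W)`. -/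
theorem star_phiLMap {W' : Type*} [AddCommGroup W'] [Module (U.Zhu 0) W']
    (f : W →ₗ[U.Zhu 0] W') (x : U.MTA) (y : U.PhiL W) :
    star x (phiLMap f y) = phiLMap f (star x y) := by
  refine mta_induction (P := fun x => star x (phiLMap f y) = phiLMap f (star x y)) x ?_ ?_ ?_
  · rw [zero_star, zero_star, map_zero]
  · intro α a α'
    refine phiL_induction (P := fun y => star (U.mtaTmul α a α') (phiLMap f y) =
      phiLMap f (star (U.mtaTmul α a α') y)) y ?_ ?_ ?_
    · rw [map_zero, star_zero, star_zero, map_zero]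
    · intro β m
      rw [phiLMap_tmul, star_tmul, star_tmul, phiLMap_tmul, map_smul, map_smul]
    · intro y y' h h'
      rw [map_add, star_add, star_add, map_add, h, h']
  · intro x x' h h'
    rw [add_star, add_star, map_add, h, h']

/-- An element of `𝔄` that acts as the identity on `Φ^L(A_0)_d` acts as the identity on `Φ^L(W)_d`
for all `W`. -/
theorem star_eq_self {d : ℤ} {x : U.MTA} (hx : ∀ y ∈ U.phiLDeg (U.Zhu 0) d, star x y = y)
    {y : U.PhiL W} (hy : y ∈ U.phiLDeg W d) : star x y = y := by
  induction hy using AddSubgroup.closure_induction with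
  | mem y hy =>
    obtain ⟨α, hα, m, rfl⟩ := hy
    have h := hx (U.phiLTmul α 1) (AddSubgroup.subset_closure ⟨α, hα, _, rfl⟩)
    -- Each generator `α ⊗ m` is the image of `α ⊗ 1` under the map induced by `A_0 → W`, `a ↦ a m`.
    have h' : phiLMap (LinearMap.toSpanSingleton (U.Zhu 0) W m) (U.phiLTmul α 1) =
        U.phiLTmul α m := by
      rw [phiLMap_tmul, LinearMap.toSpanSingleton_apply, one_smul]
    rw [← h', star_phiLMap, h]
  | zero => rw [star_zero]
  | add _ _ _ _ h h' => rw [star_add, h, h']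
  | neg y _ h =>
    rw [star_neg, h]

/-! ### The filtration of `Φ^L(W)` by degree. -/

variable (U W) in
/-- The sum of the parts of `Φ^L(W)` of degree `< n`. -/
def phiLDegLT (n : ℤ) : AddSubgroup (U.PhiL W) := ⨆ i : Set.Iio n, U.phiLDeg W i

theorem smul_mem_phiLDeg {p q : ℤ} {γ : U.carrier} (hγ : γ ∈ U.deg p) {y : U.PhiL W}
    (hy : y ∈ U.phiLDeg W q) : γ • y ∈ U.phiLDeg W (p + q) := by
  induction hy using AddSubgroup.closure_induction with
  | mem y hy =>
    obtain ⟨α, hα, m, rfl⟩ := hy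
    exact AddSubgroup.subset_closure ⟨γ * α, SetLike.mul_mem_graded hγ hα, m, rfl⟩
  | zero => rw [smul_zero]; exact zero_mem _
  | add _ _ _ _ h h' => rw [smul_add]; exact add_mem h h'
  | neg _ _ h => rw [smul_neg]; exact neg_mem h

/-- An element of degree at most `-1` lies in `N^1 U`, which is zero in the induced module. -/
theorem AlmostCanonical.phiLDeg_eq_bot (hU : U.AlmostCanonical) {p : ℤ} (hp : p < 0) :
    U.phiLDeg W p = ⊥ := by
  rw [phiLDeg, AddSubgroup.closure_eq_bot_iff]
  rintro _ ⟨α, hα, m, rfl⟩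
  exact phiLTmul_nbhd (hU.mem_nbhd hα (by lia)) m

theorem AlmostCanonical.phiLDegLT_eq_bot (hU : U.AlmostCanonical) {n : ℤ} (hn : n ≤ 0) :
    U.phiLDegLT W n = ⊥ :=
  iSup_eq_bot.2 fun i => hU.phiLDeg_eq_bot (i.2.trans_le hn)

theorem phiLDegLT_mono {m n : ℤ} (h : m ≤ n) : U.phiLDegLT W m ≤ U.phiLDegLT W n :=
  iSup_le fun i => le_iSup (fun i : Set.Iio n => U.phiLDeg W i) ⟨i, i.2.trans_le h⟩

theorem phiLDeg_le_phiLDegLT {p n : ℤ} (h : p < n) : U.phiLDeg W p ≤ U.phiLDegLT W n :=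
  le_iSup (fun i : Set.Iio n => U.phiLDeg W i) ⟨p, h⟩

theorem phiLDegLT_succ_le (n : ℤ) :
    U.phiLDegLT W (n + 1) ≤ U.phiLDeg W n ⊔ U.phiLDegLT W n := by
  refine iSup_le fun i => ?_
  rcases (Int.lt_add_one_iff.1 i.2).eq_or_lt with h | h
  · rw [h]; exact le_sup_left
  · exact (phiLDeg_le_phiLDegLT h).trans le_sup_right

theorem smul_mem_phiLDegLT {p n : ℤ} {γ : U.carrier} (hγ : γ ∈ U.deg p) {y : U.PhiL W}
    (hy : y ∈ U.phiLDegLT W n) : γ • y ∈ U.phiLDegLT W (p + n) := by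
  refine AddSubgroup.iSup_induction (fun i : Set.Iio n => U.phiLDeg W i)
    (C := fun y => γ • y ∈ U.phiLDegLT W (p + n)) hy ?_ ?_ ?_
  · intro i y hy
    exact phiLDeg_le_phiLDegLT (add_lt_add_right i.2 p) (smul_mem_phiLDeg hγ hy)
  · rw [smul_zero]; exact zero_mem _
  · intro x y h h'
    rw [smul_add]; exact add_mem h h'

theorem exists_mem_phiLDegLT (z : U.PhiL W) : ∃ n : ℕ, z ∈ U.phiLDegLT W n := by
  refine phiL_induction (P := fun z => ∃ n : ℕ, z ∈ U.phiLDegLT W n) z ⟨0, zero_mem _⟩ ?_ ?_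
  · intro α m
    refine DirectSum.Decomposition.inductionOn U.deg
      (motive := fun α => ∃ n : ℕ, U.phiLTmul α m ∈ U.phiLDegLT W n) ⟨0, ?_⟩ ?_ ?_ α
    · rw [phiLTmul_zero_left]; exact zero_mem _
    · intro p α
      exact ⟨p.toNat + 1, phiLDeg_le_phiLDegLT (by lia)
        (AddSubgroup.subset_closure ⟨α, α.2, m, rfl⟩)⟩
    · rintro α β ⟨n, h⟩ ⟨n', h'⟩
      refine ⟨max n n', ?_⟩
      rw [phiLTmul_add_left]
      exact add_mem (phiLDegLT_mono (by lia) h) (phiLDegLT_mono (by lia) h')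
  · rintro x y ⟨n, h⟩ ⟨n', h'⟩
    exact ⟨max n n', add_mem (phiLDegLT_mono (by lia) h) (phiLDegLT_mono (by lia) h')⟩

theorem exists_eq_phiLTmul_one {y : U.PhiL W} (hy : y ∈ U.phiLDeg W 0) :
    ∃ m : W, y = U.phiLTmul 1 m := by
  induction hy using AddSubgroup.closure_induction with
  | mem y hy =>
    obtain ⟨α, hα, m, rfl⟩ := hy
    refine ⟨U.zhuMk 0 ⟨α, hα⟩ • m, ?_⟩
    rw [← phiLTmul_mul, one_mul]
  | zero => exact ⟨0, (phiLTmul_zero_right _).symm⟩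
  | add _ _ _ _ h h' =>
    obtain ⟨m, rfl⟩ := h
    obtain ⟨m', rfl⟩ := h'
    exact ⟨m + m', (phiLTmul_add_right _ _ _).symm⟩
  | neg _ _ h =>
    obtain ⟨m, rfl⟩ := h
    refine ⟨-m, neg_eq_of_add_eq_zero_left ?_⟩
    rw [← phiLTmul_add_right, neg_add_cancel, phiLTmul_zero_right]

/-! ### Non-zero elements of degree `0` in submodules. -/

theorem smul_eq_zero_of_mem_degMulNeg {d : ℤ} {r : U.carrier} (hr : r ∈ U.degMulNeg d)
    {z : U.PhiL W} (hz : ∀ β ∈ U.deg (-d), β • z = 0) : r • z = 0 := by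
  induction hr using AddSubgroup.closure_induction with
  | mem r hr =>
    obtain ⟨α, -, β, hβ, rfl⟩ := hr
    rw [mul_smul, hz β hβ, smul_zero]
  | zero => rw [zero_smul]
  | add _ _ _ _ h h' => rw [add_smul, h, h', add_zero]
  | neg _ _ h => rw [neg_smul, h, neg_zero]

/-- In the presence of strong identity elements, every non-zero submodule of `Φ^L(W)` contains a
non-zero element of degree `0`. -/
theorem AlmostCanonical.exists_phiLTmul_one_mem (hU : U.AlmostCanonical)
    (hI : U.HasStrongIdentities) {Z : Submodule U.carrier (U.PhiL W)} (hZ : Z ≠ ⊥) :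
    ∃ m : W, U.phiLTmul 1 m ∈ Z ∧ U.phiLTmul 1 m ≠ 0 := by
  obtain ⟨z, hzZ, hz0⟩ := Z.exists_mem_ne_zero_of_ne_bot hZ
  classical
  have hex := exists_mem_phiLDegLT z
  have hmin := fun {m : ℕ} => Nat.find_min (m := m) hex
  have hmem := Nat.find_spec hex
  -- `n` is the least strict bound for the degrees in `z`, so for `n = d + 1` the leading part has
  -- degree `d`. Minimality makes directness of the sum of the degree parts unnecessary.
  generalize Nat.find hex = n at hmin hmem
  obtain _ | d := n
  · rw [Nat.cast_zero, hU.phiLDegLT_eq_bot le_rfl] at hmem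
    exact absurd hmem hz0
  rw [Nat.cast_succ] at hmem
  obtain ⟨w, hw, y, hy, rfl⟩ := AddSubgroup.mem_sup.1 (phiLDegLT_succ_le _ hmem)
  -- `y` has degrees below `d`, so `β • y` has negative degrees only.
  have hβy : ∀ β ∈ U.deg (-d), β • y = 0 := fun β hβ => by
    have h := smul_mem_phiLDegLT hβ hy
    rwa [hU.phiLDegLT_eq_bot (by lia), AddSubgroup.mem_bot] at h
  have hβ : ∃ β ∈ U.deg (-d), β • (w + y) ≠ 0 := by
    by_contra! hcon
    -- If `U_{-d}` killed `w + y`, then so would `r ∈ U_d U_{-d}`. As `r` kills `y` and acts on `w`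
    -- as the strong identity, `w = 0`, so the bound `d + 1` was not minimal.
    obtain ⟨e, -, he⟩ := hI d
    obtain ⟨r, hr, -, hact⟩ := exists_star_eq_smul.{u, w} e.2
    have h1 := smul_eq_zero_of_mem_degMulNeg hr hcon
    rw [smul_add, smul_eq_zero_of_mem_degMulNeg hr hβy, add_zero, ← hact W w hw,
      star_eq_self he hw] at h1
    rw [h1, zero_add] at hmin
    exact hmin d.lt_succ_self hy
  obtain ⟨β, hβ, hne⟩ := hβ
  have hw0 := smul_mem_phiLDeg hβ hw
  rw [neg_add_cancel] at hw0
  obtain ⟨m, hm⟩ := exists_eq_phiLTmul_one hw0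
  have hm' : U.phiLTmul 1 m = β • (w + y) := by rw [smul_add, hβy β hβ, add_zero, hm]
  exact ⟨m, hm' ▸ Z.smul_mem β hzZ, hm' ▸ hne⟩

end Submodules

end SeminormedGradedRing

/-! ### The seminorm of a graded completion is almost canonical -/

section Completion

open SeminormedGradedRing

variable {R : Type u} [Ring R] {𝒜 : ℤ → AddSubgroup R} [SetLike.GradedMonoid 𝒜]

/-- A representative `u ∈ R_p` is the product `1 * u` with right factor of degree `p ≤ -n`. -/
theorem complNbhd_eq_top {n p : ℤ} (h : p ≤ -n) : complNbhd 𝒜 n p = ⊤ := by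
  refine eq_top_iff.2 fun x _ => ?_
  obtain ⟨u, hu⟩ := exists_isRep x n
  rw [mem_complNbhd hu]
  refine AddSubgroup.subset_closure ⟨p, h, 1, ?_, u, u.2, (one_mul _).symm⟩
  rw [sub_self]
  exact SetLike.GradedOne.one_mem

/-- Elements of `gradedNbhd` are finite sums of products, and the map from the uncompleted ring
respects sums and products; no limit is needed. -/
theorem toCompl_mem_closure (J : TwoSidedIdeal (Compl 𝒜)) {n p : ℤ} {u : 𝒜 p}
    (hu : (u : R) ∈ gradedNbhd 𝒜 n p) :
    quotOf J p (toCompl 𝒜 p u) ∈ (complQuotRing J).canonicalNbhd n := by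
  have key : ∀ x ∈ gradedNbhd 𝒜 n p, ∃ h : x ∈ 𝒜 p,
      quotOf J p (toCompl 𝒜 p ⟨x, h⟩) ∈ (complQuotRing J).canonicalNbhd n := by
    intro x hx
    induction hx using AddSubgroup.closure_induction with
    | mem x hx =>
      obtain ⟨j, hj, x, hx, y, hy, rfl⟩ := hx
      have hxy := SetLike.mul_mem_graded hx hy
      have hp : p - j + j = p := sub_add_cancel p j
      refine ⟨by rwa [hp] at hxy, AddSubgroup.subset_closure
        ⟨quotOf J (p - j) (toCompl 𝒜 _ ⟨x, hx⟩), quotOf J j (toCompl 𝒜 _ ⟨y, hy⟩), j, hj,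
          ⟨_, rfl⟩, ?_⟩⟩
      refine Eq.trans ?_ (quotOf_mul J _ _).symm
      -- The product lives in degree `p - j + j`, which equals `p` only propositionally, so the two
      -- elements are compared as pairs of a degree and an element.
      have h := compl_sigma_ext hp (x := complMul (toCompl 𝒜 _ ⟨x, hx⟩) (toCompl 𝒜 _ ⟨y, hy⟩))
        (y := toCompl 𝒜 p ⟨x * y, by rwa [hp] at hxy⟩)
        fun n => ⟨_, _, rfl, (isRep_toCompl _).mul (isRep_toCompl _), isRep_toCompl _⟩
      exact (congrArg (fun z : GradedMonoid fun p => complPiece 𝒜 p => quotOf J z.1 z.2) h).symm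
    | zero =>
      refine ⟨zero_mem _, ?_⟩
      have : toCompl 𝒜 p ⟨0, zero_mem _⟩ = 0 :=
        compl_ext fun n => ⟨0, isRep_toCompl _, isRep_zero⟩
      rw [this, map_zero]
      exact zero_mem _
    | add x y _ _ h h' =>
      obtain ⟨hx, h⟩ := h
      obtain ⟨hy, h'⟩ := h'
      refine ⟨add_mem hx hy, ?_⟩
      have : toCompl 𝒜 p ⟨x + y, add_mem hx hy⟩ = toCompl 𝒜 p ⟨x, hx⟩ + toCompl 𝒜 p ⟨y, hy⟩ :=
        compl_ext fun n => ⟨_, isRep_toCompl _, (isRep_toCompl _).add (isRep_toCompl _)⟩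
      rw [this, map_add]
      exact add_mem h h'
    | neg x _ h =>
      obtain ⟨hx, h⟩ := h
      refine ⟨neg_mem hx, ?_⟩
      have : toCompl 𝒜 p ⟨-x, neg_mem hx⟩ = -toCompl 𝒜 p ⟨x, hx⟩ := by
        rw [eq_neg_iff_add_eq_zero]
        refine compl_ext fun n => ⟨_, (isRep_toCompl _).add (isRep_toCompl _), ?_⟩
        convert isRep_zero using 1
        exact Subtype.ext (neg_add_cancel x)
      rw [this, map_neg]
      exact neg_mem h
  exact (key u hu).2

theorem exists_eq_quotOf (J : TwoSidedIdeal (Compl 𝒜)) {n p : ℤ} {x : ComplQuot J}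
    (hx : x ∈ quotNbhd J n) (hxp : x ∈ quotDeg J p) : ∃ y ∈ complNbhd 𝒜 n p, x = quotOf J p y := by
  obtain ⟨y, hy, e⟩ := quotNbhd_homog J n x hx p
  rw [DirectSum.decompose_of_mem_same (quotDeg J) hxp] at e
  exact ⟨y, hy, e⟩

theorem almostCanonical_complQuotRing (J : TwoSidedIdeal (Compl 𝒜)) :
    (complQuotRing J).AlmostCanonical := by
  have hcan : ∀ n p, (complQuotRing J).canonicalNbhd n ⊓ (complQuotRing J).deg p ≤
      (complQuotRing J).nbhd n := by
    rintro n p z ⟨hz, hzp⟩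
    rw [← comp_of_mem hzp]
    refine (AddSubgroup.closure_le _).2 ?_ (comp_canonicalNbhd hz p)
    rintro _ ⟨j, hj, x, hx, _, ⟨y, rfl⟩, rfl⟩
    -- The right factor has degree `j ≤ -n`, so it already lies in the `n`-th neighbourhood, which
    -- is stable under left multiplication by homogeneous elements.
    refine (complQuotRing J).mul_nbhd n (p - j) j _ _ hx ?_ ⟨y, rfl⟩
    exact mem_quotNbhd_of J (by rw [complNbhd_eq_top hj]; trivial)
  intro n p
  refine le_antisymm ?_ (sup_le (le_inf (hcan n p) inf_le_right)
    (inf_le_inf_right _ ((complQuotRing J).nbhd_anti n)))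
  rintro x ⟨hx, hxp⟩
  obtain ⟨y, hy, hxy⟩ := exists_eq_quotOf J hx hxp
  -- Approximation to order `n + 1` makes `y - u` an element of `N^{n+1}`; since `y ∈ N^n`, the
  -- uncompleted `u` lies in the canonical neighbourhood of index `n`.
  obtain ⟨u, hu⟩ := exists_isRep y (n + 1)
  have hun := (mem_complNbhd (hu.mono (by lia))).1 hy
  refine AddSubgroup.mem_sup.2 ⟨quotOf J p (toCompl 𝒜 p u), ⟨toCompl_mem_closure J hun, ⟨_, rfl⟩⟩,
    quotOf J p (y - toCompl 𝒜 p u), ⟨mem_quotNbhd_of J ?_, ⟨_, rfl⟩⟩, ?_⟩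
  · change y.1 (n + 1) - gq 𝒜 (n + 1) p u = 0
    rw [hu _ le_rfl, sub_self]
  · rw [hxy, map_sub]
    exact add_sub_cancel _ _

end Completion

/-! ### The splitting theorem assembled, and `L_0` on the degree `0` part. -/

namespace SeminormedGradedRing

theorem AlmostCanonical.exact_and_splits {U : SeminormedGradedRing.{u}} (hU : U.AlmostCanonical)
    (d : ℕ) :
    (Function.Surjective (U.zhuProj d) ∧ Function.Exact (U.mu d) (U.zhuProj d)) ∧
    (U.HasIdentity d → Function.Injective (U.mu d) ∧ U.SplitsAsProduct d) ∧
    ((∀ j ≤ d, U.HasIdentity j) → Nonempty (U.Zhu d ≃+* ∀ j : Fin (d + 1), U.MTAd j)) := by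
  refine ⟨⟨zhuProj_surjective _, hU.exact_mu_zhuProj d⟩,
    fun h => ⟨mu_injective d h, hU.splitsAsProduct d h⟩, fun h => ?_⟩
  have := hU.nonempty_zhu_ringEquiv_pi (d + 1) fun j hj => h j (Nat.lt_succ_iff.1 hj)
  rwa [show ((d + 1 : ℕ) : ℤ) - 1 = d by push_cast; ring] at this

end SeminormedGradedRing

namespace VertexOperatorAlgebra

open SeminormedGradedRing

theorem isL0Eigenvalue_of_phiLTmul_one {V : Type v} [AddCommGroup V] [Module ℂ V]
    (A : VertexOperatorAlgebra V) {W : Type w} [AddCommGroup W] [Module (A.univEnv.Zhu 0) W]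
    {c : ℂ} (hc : ∀ x : W, A.univEnv.zhuMk 0 A.opL0 • x = A.univEnv.zhuMk 0 (A.scalar c) • x)
    {Z : Submodule A.univEnv.carrier (A.univEnv.PhiL W)} {m : W}
    (hm : A.univEnv.phiLTmul 1 m ∈ Z) (hm0 : A.univEnv.phiLTmul 1 m ≠ 0) :
    A.IsL0Eigenvalue Z c := by
  refine ⟨_, hm, hm0, ?_⟩
  -- Writing `L_0` as `1 * L_0` lets it pass across the tensor sign to `m`, where it acts as the
  -- scalar `c`.
  rw [smul_phiLTmul, smul_phiLTmul, mul_one, mul_one, ← one_mul (A.opL0 : A.univEnv.carrier),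
    ← one_mul (A.scalar c : A.univEnv.carrier), phiLTmul_mul, phiLTmul_mul, hc]

end VertexOperatorAlgebra

end ModeAlg

theorem theorem6p0p1 :
    -- the abstract splitting theorem
    (∀ U : ModeAlg.SeminormedGradedRing.{u}, U.AlmostCanonical → ∀ d : ℕ,
      (Function.Surjective (U.zhuProj d) ∧ Function.Exact (U.mu d) (U.zhuProj d)) ∧
      (U.HasIdentity d → Function.Injective (U.mu d) ∧ U.SplitsAsProduct d) ∧
      ((∀ j ≤ d, U.HasIdentity j) → Nonempty (U.Zhu d ≃+* ∀ j : Fin (d + 1), U.MTAd j))) ∧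
    -- the case of a vertex operator algebra
    (∀ (V : Type v) [AddCommGroup V] [Module ℂ V] (A : ModeAlg.VertexOperatorAlgebra V),
      (∀ d : ℕ,
        (Function.Surjective (A.univEnv.zhuProj d) ∧
          Function.Exact (A.univEnv.mu d) (A.univEnv.zhuProj d)) ∧
        (A.univEnv.HasIdentity d →
          Function.Injective (A.univEnv.mu d) ∧ A.univEnv.SplitsAsProduct d) ∧
        ((∀ j ≤ d, A.univEnv.HasIdentity j) →
          Nonempty (A.univEnv.Zhu d ≃+* ∀ j : Fin (d + 1), A.univEnv.MTAd j))) ∧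
      (A.univEnv.HasStrongIdentities →
        ∀ (W₀ : Type w) [AddCommGroup W₀] [Module (A.univEnv.Zhu 0) W₀] (c : ℂ),
          (∀ x : W₀, A.univEnv.zhuMk 0 A.opL0 • x = A.univEnv.zhuMk 0 (A.scalar c) • x) →
          ¬ ∃ Z : Submodule A.univEnv.carrier (A.univEnv.PhiL W₀), Z ≠ ⊥ ∧ Z ≠ ⊤ ∧
            ∀ cZ : ℂ, A.IsL0Eigenvalue Z cZ → ∃ k : ℤ, 0 < k ∧ cZ - c = k)) := by
  refine ⟨fun U hU d => hU.exact_and_splits d, fun V _ _ A => ?_⟩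
  have hU : A.univEnv.AlmostCanonical := ModeAlg.almostCanonical_complQuotRing _
  refine ⟨fun d => hU.exact_and_splits d, ?_⟩
  rintro hI W₀ _ _ c hc ⟨Z, hZ, -, hpos⟩
  obtain ⟨m, hm, hm0⟩ := hU.exists_phiLTmul_one_mem hI hZ
  -- The scalar `c` is itself an eigenvalue on `Z`, which forces `k = 0`.
  obtain ⟨k, hk, h⟩ := hpos c (A.isL0Eigenvalue_of_phiLTmul_one hc hm hm0)
  rw [sub_self, eq_comm, Int.cast_eq_zero] at h
  exact hk.ne' h
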